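/- Let $n\ge 1$ and let $f\colon\mathbb R^{n}\times\mathbb R\to\mathbb C$ be a compactly supported $C^\infty$ function that is even in the last variable, $f(x,-y)=f(x,y)$. Let $S^n$ be the unit sphere of $\mathbb R^{n+1}$ with surface measure $dS$ and area $|S^n|$. Let $$g(x,r)=Rf(x,r)=\frac1{|S^n|}\int_{S^n} f(x+r\xi,\,r\eta)\,dS(\xi,\eta)$$ be the spherical means of $f$, and let $$R^*_\partial g(x,y)=\int_{\mathbb R^n}\frac{\partial}{\partial y}\,g\bigl(z,\sqrt{\|x-z\|^2+y^2}\bigr)\,dz .$$ Here $(-\Delta)^{s}$ denotes the Fourier multiplier on $\mathbb R^{n+1}$ with symbol $(\|\xi\|^2+\eta^2)^{s}$ in the angular frequencies $(\xi,\eta)$; it acts on a function whose distributional Fourier transform is a function by multiplying that Fourier transform by the symbol. For $\varphi\in L^2(\mathbb R)$, $H\varphi(y)=\frac1\pi\lim_{\varepsilon\to0+}\int_{|y-t|>\varepsilon}\frac{\varphi(t)}{y-t}\,dt$ is the Hilbert transform, and $H_y$ is the Hilbert transform in the variable $y$ for fixed $x$. Then: 1. For all $(x,y)$ and all $r$, the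 integrals defining $Rf(x,r)$ and $R^*_\partial g(x,y)$ converge absolutely, and the derivative under the second integral exists for every $z$. 2. There is exactly one continuous function $v=(-\Delta)^{\frac{n-1}{2}}R^*_\partial g$ on $\mathbb R^{n+1}$. For every $x$ the function $v(x,\cdot)$ lies in $L^2(\mathbb R)$, its Hilbert transform exists at every point as a principal value of absolutely convergent truncated integrals, and at every point $$f=c_n\,H_y\,(-\Delta)^{\frac{n-1}{2}}R^*_\partial g,\qquad c_n=\frac{1}{(2\pi)^n}\,\frac{|S^n|}{2}.$$ 3. In contrast, without the derivative the backprojection integral diverges: if $f\ge 0$ and $f(x,y)>0$, then $z\mapsto g\bigl(z,\sqrt{\|x-z\|^2+y^2}\bigr)$ is not integrable over $\mathbb R^n$. -/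

import Mathlib

open MeasureTheory Filter Topology FourierTransform
open scoped SchwartzMap ContDiff

noncomputable section

namespace SphericalRadon

/-- The Euclidean space of the variables `x`. -/
abbrev X (n : ℕ) : Type := EuclideanSpace ℝ (Fin n)

/-- `ℝⁿ⁺¹ = ℝⁿ × ℝ` with its Euclidean norm; a point is `(x, y)` with `x ∈ ℝⁿ`, `y ∈ ℝ`. -/
abbrev XY (n : ℕ) : Type := WithLp 2 (X n × ℝ)

/-- The point `(x, y)` of `ℝⁿ⁺¹`. -/
abbrev pt {n : ℕ} (x : X n) (y : ℝ) : XY n := WithLp.toLp 2 (x, y)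

/-- The unit sphere `Sⁿ` of `ℝⁿ⁺¹`. -/
abbrev Sph (n : ℕ) : Set (XY n) := Metric.sphere (0 : XY n) 1

/-- The canonical surface measure on `Sⁿ`. -/
def surface (n : ℕ) : Measure (Sph n) := (volume : Measure (XY n)).toSphere

/-- The surface area `|Sⁿ|`. -/
def sphereArea (n : ℕ) : ℝ := (surface n).real Set.univ

/-- Spherical means with centres on the hyperplane `y = 0`:
`R f (x, r) = |Sⁿ|⁻¹ ∫_{Sⁿ} f (x + r ξ, r η) dS(ξ, η)`. -/
def R {n : ℕ} (f : XY n → ℂ) (x : X n) (r : ℝ) : ℂ :=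
  ((sphereArea n)⁻¹ : ℝ) *
    ∫ w : Sph n, f (pt (x + r • (w : XY n).fst) (r * (w : XY n).snd)) ∂(surface n)

/-- The integrand `g (z, √(‖z - x‖² + y²))` of the (unmodified) backprojection. -/
def bp {n : ℕ} (g : X n → ℝ → ℂ) (x : X n) (y : ℝ) (z : X n) : ℂ :=
  g z (Real.sqrt (‖z - x‖ ^ 2 + y ^ 2))

/-- The modified backprojection
`R*_∂ g (x, y) = ∫_{ℝⁿ} ∂/∂y [g (z, √(‖z - x‖² + y²))] dz`. -/
def modBackproj {n : ℕ} (g : X n → ℝ → ℂ) (p : XY n) : ℂ :=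
  ∫ z : X n, deriv (fun t : ℝ => bp g p.fst t z) p.snd

/-- The function `u`, read as a tempered distribution, has the function `w` as its Fourier
transform: `⟨u, 𝓕 φ⟩ = ⟨w, φ⟩` for every Schwartz function `φ`, all the integrals being absolutely
convergent. Here `𝓕 φ (k) = ∫ exp (-2 π i ⟨v, k⟩) φ v dv`. -/
def IsFourierTransform {n : ℕ} (u w : XY n → ℂ) : Prop :=
  ∀ φ : 𝓢(XY n, ℂ),
    Integrable (fun p => u p * (𝓕 φ) p) ∧ Integrable (fun k => w k * φ k) ∧
      ∫ p, u p * (𝓕 φ) p = ∫ k, w k * φ k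

/-- `v` is the continuous function `(-Δ)^s u` on `ℝⁿ⁺¹`: the Fourier transform of `u` is a function
`w`, and `v` has the Fourier transform `(2 π ‖k‖)^(2 s) w(k)`. (With the normalisation of `𝓕`
above, `-Δ` is the Fourier multiplier `(2 π ‖k‖)²`.) -/
def IsFracLaplacian {n : ℕ} (s : ℝ) (u v : XY n → ℂ) : Prop :=
  Continuous v ∧ ∃ w : XY n → ℂ, IsFourierTransform u w ∧
    IsFourierTransform v (fun k => (((2 * Real.pi * ‖k‖) ^ (2 * s) : ℝ) : ℂ) * w k)

/-- `h` is the Hilbert transform of `φ ∈ L²(ℝ)`, at every point, as a principal value: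
`h(y) = π⁻¹ lim_{ε → 0+} ∫_{|y - t| > ε} φ(t) / (y - t) dt`, where the truncated integrals
converge absolutely. -/
def IsHilbertTransform (φ h : ℝ → ℂ) : Prop :=
  MemLp φ 2 volume ∧ ∀ y : ℝ,
    (∀ ε : ℝ, 0 < ε → IntegrableOn (fun t : ℝ => φ t / ((y - t : ℝ) : ℂ)) {t | ε < |y - t|}) ∧
    Tendsto (fun ε : ℝ => ((Real.pi⁻¹ : ℝ) : ℂ) *
      ∫ t in {t : ℝ | ε < |y - t|}, φ t / ((y - t : ℝ) : ℂ)) (𝓝[>] 0) (𝓝 (h y))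

/-- The constant `c_n = |Sⁿ| / (2 (2 π)ⁿ)`. -/
def c (n : ℕ) : ℝ := sphereArea n / (2 * (2 * Real.pi) ^ n)

end SphericalRadon

end

open SphericalRadon

/-! Everything is computed on the Fourier side. Write `f = 𝓕⁻ g` with `g` Schwartz. The spherical
mean of a plane wave of frequency `k` depends only on radius times `‖k‖`. By
`sphere_integral_e_symm` the radius `‖(z - x, y)‖` and the frequency norm `‖k‖` can therefore trade
places. The variable `y` then enters the exponent linearly, and the square root is gone before
differentiating.

The `y`-derivative brings down the height of the point on the sphere. That is exactly the Jacobian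
for projecting the sphere of radius `‖k‖` to the hyperplane (`sphere_integral_snd_mul`). So, as a
function of `z - x`, the backprojection integrand is an inverse Fourier transform, of `profile`
(`deriv_bp_eq_fourierInv`). Integrating in `z` evaluates `profile` at `0`, where the root `√(‖k‖² -
‖k.fst‖²)` becomes `|k.snd|`. For even `f` this makes the backprojection the Fourier multiplier
`(4πi / |Sⁿ|) sgn(k.snd) ‖k‖^(1-n)` applied to `f` (`modBackproj_eq_fourierInv`). The power
`(2π‖k‖)^(n-1)` cancels the radial factor and leaves `i sgn(k.snd) / c n`. The Hilbert transform, of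
symbol `-i sgn`, removes the sign.

Three analytic points remain. Evaluating at `0` needs the integrand to be integrable in `z`: near
`x` it is bounded as an inverse transform, and far away it is `O(‖z - x‖^(-n-1))`. This is because a
large sphere meets the support in a fraction `O(r^(-n))` of its area and the radius varies with `y`
at rate `O(1/r)` (`norm_deriv_bp_R_le`). Without the derivative only `r^(-n)` is left, and a
matching lower bound gives divergence in `ℝⁿ` (`not_integrable_bp`). The pointwise principal value
reduces to the sine integral and its limit `π/2` (`isHilbertTransform_signTransform`). -/

namespace SphericalRadon

/-! ### Polar coordinates, and the share of a sphere lying in a ball. -/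

section Polar

open Set Measure Module

variable {E : Type*} [NormedAddCommGroup E] [NormedSpace ℝ E] [MeasurableSpace E] [BorelSpace E]
  [FiniteDimensional ℝ E] [Nontrivial E]

theorem lintegral_eq_lintegral_polar (μ : Measure E) [μ.IsAddHaarMeasure] {F : E → ENNReal}
    (hF : Measurable F) :
    ∫⁻ p, F p ∂μ = ∫⁻ r in Ioi (0 : ℝ), ENNReal.ofReal (r ^ (finrank ℝ E - 1)) *
      ∫⁻ w : Metric.sphere (0 : E) 1, F (r • (w : E)) ∂μ.toSphere := by
  have hmeas : Measurable fun q : Metric.sphere (0 : E) 1 × ℝ => F (q.2 • (q.1 : E)) :=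
    hF.comp (by fun_prop)
  have hG : Measurable fun q : Metric.sphere (0 : E) 1 × Ioi (0 : ℝ) => F ((q.2 : ℝ) • (q.1 : E)) :=
    hF.comp (by fun_prop)
  have hH : Measurable fun r : ℝ => ∫⁻ w : Metric.sphere (0 : E) 1, F (r • (w : E)) ∂μ.toSphere :=
    hmeas.lintegral_prod_left'
  calc ∫⁻ p, F p ∂μ = ∫⁻ x : ({(0)}ᶜ : Set E), F x ∂(μ.comap (↑)) := by
        rw [lintegral_subtype_comap (measurableSet_singleton _).compl, restrict_compl_singleton]
    _ = ∫⁻ q, F ((q.2 : ℝ) • (q.1 : E)) ∂(μ.toSphere.prod (volumeIoiPow (finrank ℝ E - 1))) := by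
        rw [← μ.measurePreserving_homeomorphUnitSphereProd.lintegral_comp_emb
          (Homeomorph.measurableEmbedding _)]
        refine lintegral_congr fun x => ?_
        congr 1
        exact (congrArg Subtype.val ((homeomorphUnitSphereProd E).symm_apply_apply x)).symm
    _ = ∫⁻ r : Ioi (0 : ℝ), ∫⁻ w : Metric.sphere (0 : E) 1, F ((r : ℝ) • (w : E)) ∂μ.toSphere
          ∂(volumeIoiPow (finrank ℝ E - 1)) := lintegral_prod_symm' _ hG
    _ = _ := by
        rw [volumeIoiPow, lintegral_withDensity_eq_lintegral_mul _ (by fun_prop)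
          (show Measurable fun r : Ioi (0 : ℝ) =>
            ∫⁻ w : Metric.sphere (0 : E) 1, F ((r : ℝ) • (w : E)) ∂μ.toSphere from
              hH.comp measurable_subtype_coe)]
        exact lintegral_subtype_comap measurableSet_Ioi (fun r : ℝ =>
          ENNReal.ofReal (r ^ (finrank ℝ E - 1)) *
            ∫⁻ w : Metric.sphere (0 : E) 1, F (r • (w : E)) ∂μ.toSphere)

theorem integral_eq_integral_polar (μ : Measure E) [μ.IsAddHaarMeasure] {F : E → ℂ}
    (hF : Integrable F μ) :
    ∫ p, F p ∂μ = ∫ r in Ioi (0 : ℝ), (r ^ (finrank ℝ E - 1)) •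
      ∫ w : Metric.sphere (0 : E) 1, F (r • (w : E)) ∂μ.toSphere := by
  have hcomp : ∀ x : ({(0)}ᶜ : Set E), F ((((homeomorphUnitSphereProd E) x).2 : ℝ) •
      (((homeomorphUnitSphereProd E) x).1 : E)) = F x := fun x =>
    congrArg F (congrArg Subtype.val ((homeomorphUnitSphereProd E).symm_apply_apply x))
  have hint : Integrable (fun q : Metric.sphere (0 : E) 1 × Ioi (0 : ℝ) =>
      F ((q.2 : ℝ) • (q.1 : E))) (μ.toSphere.prod (volumeIoiPow (finrank ℝ E - 1))) := by
    rw [← μ.measurePreserving_homeomorphUnitSphereProd.integrable_comp_emb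
      (Homeomorph.measurableEmbedding _)]
    simp only [Function.comp_def, hcomp]
    have : IntegrableOn F ({0}ᶜ) μ := hF.integrableOn
    rwa [integrableOn_iff_comap_subtypeVal (measurableSet_singleton _).compl] at this
  calc ∫ p, F p ∂μ = ∫ x : ({(0)}ᶜ : Set E), F x ∂(μ.comap (↑)) := by
        rw [integral_subtype_comap (measurableSet_singleton _).compl, restrict_compl_singleton]
    _ = ∫ q, F ((q.2 : ℝ) • (q.1 : E)) ∂(μ.toSphere.prod (volumeIoiPow (finrank ℝ E - 1))) := by
        rw [← μ.measurePreserving_homeomorphUnitSphereProd.integral_comp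
          (Homeomorph.measurableEmbedding _)]
        simp only [hcomp]
    _ = ∫ r : Ioi (0 : ℝ), ∫ w : Metric.sphere (0 : E) 1, F ((r : ℝ) • (w : E)) ∂μ.toSphere
          ∂(volumeIoiPow (finrank ℝ E - 1)) := integral_prod_symm _ hint
    _ = _ := by
        simp only [volumeIoiPow, ENNReal.ofReal]
        rw [integral_withDensity_eq_integral_smul (by fun_prop),
          integral_subtype_comap measurableSet_Ioi fun r : ℝ =>
            Real.toNNReal (r ^ (finrank ℝ E - 1)) •
              ∫ w : Metric.sphere (0 : E) 1, F (r • (w : E)) ∂μ.toSphere]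
        refine setIntegral_congr_fun measurableSet_Ioi fun r hr => ?_
        simp only [NNReal.smul_def, Real.coe_toNNReal _ (pow_nonneg (le_of_lt hr) _)]

omit [MeasurableSpace E] [BorelSpace E] [FiniteDimensional ℝ E] [Nontrivial E] in
theorem dist_smul_sphere (r s : ℝ) (w : Metric.sphere (0 : E) 1) :
    dist (r • (w : E)) (s • (w : E)) = |r - s| := by
  rw [dist_eq_norm, ← sub_smul, norm_smul, norm_eq_of_mem_sphere w, mul_one, Real.norm_eq_abs]

/-- Thicken the spherical piece radially: for `s` in `(r, r + 1)` the same directions land in the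
ball of radius `A + 1`. The volume of that ball thus dominates `r ^ (dim - 1)` times the measure of
the directions, uniformly in the centre `z`. -/
theorem toSphere_smul_mem_ball_le (μ : Measure E) [μ.IsAddHaarMeasure] (z : E) {A r : ℝ}
    (hr : 0 < r) :
    μ.toSphere.real {w | r • (w : E) ∈ Metric.ball z A} ≤
      μ.real (Metric.ball (0 : E) (A + 1)) / r ^ (finrank ℝ E - 1) := by
  set T : Set (Metric.sphere (0 : E) 1) := {w | r • (w : E) ∈ Metric.ball z A}
  have hB : μ (Metric.ball z (A + 1)) ≠ ⊤ := measure_ball_lt_top.ne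
  have key : ENNReal.ofReal (r ^ (finrank ℝ E - 1)) * μ.toSphere T ≤
      μ (Metric.ball z (A + 1)) := by
    calc ENNReal.ofReal (r ^ (finrank ℝ E - 1)) * μ.toSphere T
        = ∫⁻ _ in Ioo r (r + 1), ENNReal.ofReal (r ^ (finrank ℝ E - 1)) * μ.toSphere T := by
          simp
      _ ≤ ∫⁻ s in Ioo r (r + 1), ENNReal.ofReal (s ^ (finrank ℝ E - 1)) *
            ∫⁻ w : Metric.sphere (0 : E) 1, (Metric.ball z (A + 1)).indicator 1 (s • (w : E))
              ∂μ.toSphere := by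
          refine setLIntegral_mono' measurableSet_Ioo fun s hs => ?_
          gcongr
          · exact hs.1.le
          · rw [← lintegral_indicator_one₀]
            · refine lintegral_mono fun w => ?_
              by_cases hw : w ∈ T
              · have : s • (w : E) ∈ Metric.ball z (A + 1) := by
                  rw [Metric.mem_ball]
                  calc dist (s • (w : E)) z ≤ dist (s • (w : E)) (r • (w : E)) +
                        dist (r • (w : E)) z := dist_triangle _ _ _
                    _ < 1 + A := by
                        refine add_lt_add ?_ hw
                        rw [dist_smul_sphere, abs_of_pos] <;> linarith [hs.1, hs.2]
                    _ = A + 1 := add_comm _ _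
                simp [indicator_of_mem this, indicator_of_mem hw]
              · simp [indicator_of_notMem hw]
            · exact (measurableSet_ball.preimage (by fun_prop)).nullMeasurableSet
      _ ≤ ∫⁻ s in Ioi 0, ENNReal.ofReal (s ^ (finrank ℝ E - 1)) *
            ∫⁻ w : Metric.sphere (0 : E) 1, (Metric.ball z (A + 1)).indicator 1 (s • (w : E))
              ∂μ.toSphere :=
          lintegral_mono_set fun s hs => hr.trans hs.1
      _ = μ (Metric.ball z (A + 1)) := by
          rw [← lintegral_eq_lintegral_polar μ (measurable_one.indicator measurableSet_ball),
            lintegral_indicator_one measurableSet_ball]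
  have h2 := ENNReal.toReal_mono hB key
  rw [ENNReal.toReal_mul, ENNReal.toReal_ofReal (by positivity)] at h2
  rw [le_div_iff₀ (by positivity), mul_comm]
  refine h2.trans_eq ?_
  simp [measureReal_def, addHaar_ball_center]

/-- In polar coordinates the ball of radius `δ / 2` about `q` only uses radii within `δ / 2` of
`‖q‖`. Moving such a point radially to radius `‖q‖` costs less than `δ / 2`, so its direction is
counted on the right-hand side. -/
theorem le_toSphere_smul_mem_ball (μ : Measure E) [μ.IsAddHaarMeasure] {q : E} {δ : ℝ}
    (hδ : 0 < δ) :
    μ.real (Metric.ball (0 : E) (δ / 2)) / (δ * (‖q‖ + δ) ^ (finrank ℝ E - 1)) ≤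
      μ.toSphere.real {w | ‖q‖ • (w : E) ∈ Metric.ball q δ} := by
  set T : Set (Metric.sphere (0 : E) 1) := {w | ‖q‖ • (w : E) ∈ Metric.ball q δ}
  have key : μ (Metric.ball q (δ / 2)) ≤
      ENNReal.ofReal (δ * (‖q‖ + δ) ^ (finrank ℝ E - 1)) * μ.toSphere T := by
    calc μ (Metric.ball q (δ / 2)) = ∫⁻ s in Ioi 0, ENNReal.ofReal (s ^ (finrank ℝ E - 1)) *
            ∫⁻ w : Metric.sphere (0 : E) 1, (Metric.ball q (δ / 2)).indicator 1 (s • (w : E))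
              ∂μ.toSphere := by
          rw [← lintegral_eq_lintegral_polar μ (measurable_one.indicator measurableSet_ball),
            lintegral_indicator_one measurableSet_ball]
      _ ≤ ∫⁻ s in Ioi 0, (Ioo (‖q‖ - δ / 2) (‖q‖ + δ / 2)).indicator (fun _ =>
            ENNReal.ofReal ((‖q‖ + δ) ^ (finrank ℝ E - 1)) * μ.toSphere T) s := by
          refine setLIntegral_mono' measurableSet_Ioi fun s hs => ?_
          have hs0 : 0 < s := hs
          have aux : ∀ w : Metric.sphere (0 : E) 1, s • (w : E) ∈ Metric.ball q (δ / 2) →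
              |s - ‖q‖| < δ / 2 := by
            intro w hw
            have h1 : ‖s • (w : E)‖ = s := by
              rw [norm_smul, norm_eq_of_mem_sphere w, mul_one, Real.norm_of_nonneg hs0.le]
            have h2 := abs_norm_sub_norm_le (s • (w : E)) q
            rw [h1] at h2
            exact h2.trans_lt (by simpa [dist_eq_norm] using hw)
          by_cases hsq : |s - ‖q‖| < δ / 2
          · have h3 := abs_lt.1 hsq
            rw [indicator_of_mem (by constructor <;> linarith [h3.1, h3.2])]
            gcongr
            · linarith
            · rw [← lintegral_indicator_one₀]
              · refine lintegral_mono fun w => ?_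
                by_cases hw : s • (w : E) ∈ Metric.ball q (δ / 2)
                · have : w ∈ T := by
                    change dist (‖q‖ • (w : E)) q < δ
                    calc dist (‖q‖ • (w : E)) q ≤ dist (‖q‖ • (w : E)) (s • (w : E)) +
                          dist (s • (w : E)) q := dist_triangle _ _ _
                      _ < δ / 2 + δ / 2 := by
                          refine add_lt_add ?_ hw
                          rwa [dist_smul_sphere, abs_sub_comm]
                      _ = δ := add_halves δ
                  simp [indicator_of_mem this, indicator_of_mem hw]
                · simp [indicator_of_notMem hw]
              · exact (measurableSet_ball.preimage (by fun_prop)).nullMeasurableSet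
          · have : ∀ w : Metric.sphere (0 : E) 1,
                (Metric.ball q (δ / 2)).indicator (1 : E → ENNReal) (s • (w : E)) = 0 := fun w =>
              indicator_of_notMem (fun h => hsq (aux w h)) _
            simp [this]
      _ ≤ ∫⁻ s, (Ioo (‖q‖ - δ / 2) (‖q‖ + δ / 2)).indicator (fun _ =>
            ENNReal.ofReal ((‖q‖ + δ) ^ (finrank ℝ E - 1)) * μ.toSphere T) s :=
          setLIntegral_le_lintegral _ _
      _ = _ := by
          rw [lintegral_indicator measurableSet_Ioo, setLIntegral_const, Real.volume_Ioo,
            mul_comm, ← mul_assoc, ← ENNReal.ofReal_mul (by linarith)]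
          congr 3
          ring
  have h2 := ENNReal.toReal_mono (by finiteness) key
  rw [ENNReal.toReal_mul, ENNReal.toReal_ofReal (by positivity)] at h2
  rw [div_le_iff₀ (by positivity), mul_comm]
  refine le_trans (le_of_eq ?_) h2
  simp [measureReal_def, addHaar_ball_center]

end Polar

/-! ### Coordinates on `ℝⁿ × ℝ`. -/

section Coordinates

variable {n : ℕ}

theorem finrank_XY : Module.finrank ℝ (XY n) = n + 1 := by
  rw [(WithLp.linearEquiv 2 ℝ (X n × ℝ)).finrank_eq]
  simp

theorem measurePreserving_pt :
    MeasurePreserving (fun q : X n × ℝ => pt q.1 q.2) (volume.prod volume) volume :=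
  WithLp.volume_preserving_toLp (X n) ℝ

theorem measurableEmbedding_pt : MeasurableEmbedding (fun q : X n × ℝ => pt q.1 q.2) :=
  (MeasurableEquiv.toLp 2 (X n × ℝ)).measurableEmbedding

theorem integrable_comp_pt_iff {F : XY n → ℂ} :
    Integrable (fun q : X n × ℝ => F (pt q.1 q.2)) (volume.prod volume) ↔ Integrable F :=
  measurePreserving_pt.integrable_comp_emb measurableEmbedding_pt

theorem integral_XY_eq {F : XY n → ℂ} (hF : Integrable F) :
    ∫ p, F p = ∫ x : X n, ∫ y : ℝ, F (pt x y) := by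
  rw [← measurePreserving_pt.integral_comp measurableEmbedding_pt]
  exact integral_prod _ (integrable_comp_pt_iff.2 hF)

theorem integral_XY_eq' {F : XY n → ℂ} (hF : Integrable F) :
    ∫ p, F p = ∫ y : ℝ, ∫ x : X n, F (pt x y) := by
  rw [← measurePreserving_pt.integral_comp measurableEmbedding_pt]
  exact integral_prod_symm _ (integrable_comp_pt_iff.2 hF)

@[fun_prop]
theorem continuous_pt {α : Type*} [TopologicalSpace α] {u : α → X n} {v : α → ℝ}
    (hu : Continuous u) (hv : Continuous v) : Continuous fun a => pt (u a) (v a) :=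
  (WithLp.prod_continuous_toLp 2 (X n) ℝ).comp (hu.prodMk hv)

@[fun_prop]
theorem continuous_XY_fst : Continuous fun p : XY n => p.fst :=
  continuous_fst.comp (WithLp.prod_continuous_ofLp 2 (X n) ℝ)

@[fun_prop]
theorem continuous_XY_snd : Continuous fun p : XY n => p.snd :=
  continuous_snd.comp (WithLp.prod_continuous_ofLp 2 (X n) ℝ)

theorem norm_pt (x : X n) (y : ℝ) : ‖pt x y‖ = Real.sqrt (‖x‖ ^ 2 + y ^ 2) := by
  rw [WithLp.prod_norm_eq_of_L2]
  simp

theorem abs_snd_le_norm (p : XY n) : |p.snd| ≤ ‖p‖ := by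
  rw [WithLp.prod_norm_eq_of_L2]
  exact Real.abs_le_sqrt (by rw [Real.norm_eq_abs, sq_abs]; nlinarith [sq_nonneg ‖p.fst‖])

theorem norm_fst_le_norm (p : XY n) : ‖p.fst‖ ≤ ‖p‖ := by
  rw [WithLp.prod_norm_eq_of_L2]
  exact Real.le_sqrt_of_sq_le (by nlinarith [sq_nonneg ‖p.snd‖])

end Coordinates

/-! ### Projection of the sphere onto the hyperplane. -/

section Hemisphere

open Set

variable {n : ℕ}

instance : IsFiniteMeasure (surface n) := by unfold surface; infer_instance

/-- The substitution `r = √(d² + t²)` has `dr = (t / r) dt` on each half-line. The factor `t / r` is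
odd, so the lower half-line enters with a minus sign. -/
theorem integral_hemispheres_aux (ψ : ℝ → ℂ) (d a b : ℝ) (ha : 0 < a)
    (hint : Integrable fun t : ℝ => (Ioo a b).indicator
      (fun r => ((t / r : ℝ) : ℂ) * ψ t) (Real.sqrt (d ^ 2 + t ^ 2))) :
    ∫ t : ℝ, (Ioo a b).indicator (fun r => ((t / r : ℝ) : ℂ) * ψ t) (Real.sqrt (d ^ 2 + t ^ 2)) =
      ∫ r in Ioo a b, (ψ (Real.sqrt (r ^ 2 - d ^ 2)) - ψ (-Real.sqrt (r ^ 2 - d ^ 2))) := by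
  set G : ℝ → ℂ := fun t =>
    (Ioo a b).indicator (fun r => ((t / r : ℝ) : ℂ) * ψ t) (Real.sqrt (d ^ 2 + t ^ 2)) with hG
  set K : ℝ → ℂ := (Ioo a b).indicator fun r =>
    ψ (Real.sqrt (r ^ 2 - d ^ 2)) - ψ (-Real.sqrt (r ^ 2 - d ^ 2)) with hK
  have hsplit : ∫ t, G t = ∫ t in Ioi (0 : ℝ), (G (-t) + G t) := by
    rw [← intervalIntegral.integral_Iic_add_Ioi (b := 0) hint.integrableOn hint.integrableOn,
      integral_add hint.comp_neg.integrableOn hint.integrableOn]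
    congr 1
    have := integral_comp_neg_Ioi (0 : ℝ) G
    rw [this, neg_zero]
  have hpos : ∀ t ∈ Ioi (0 : ℝ), 0 < d ^ 2 + t ^ 2 := fun t ht => by
    have : 0 < t := ht
    positivity
  have hinj : InjOn (fun t : ℝ => Real.sqrt (d ^ 2 + t ^ 2)) (Ioi 0) := by
    intro s hs t ht hst
    have h1 := (Real.sqrt_inj (hpos s hs).le (hpos t ht).le).1 hst
    have h2 : s ^ 2 = t ^ 2 := by linarith
    exact (sq_eq_sq₀ (le_of_lt hs) (le_of_lt ht)).1 h2
  have himage : (fun t : ℝ => Real.sqrt (d ^ 2 + t ^ 2)) '' Ioi 0 = Ioi |d| := by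
    ext r
    constructor
    · rintro ⟨t, ht, rfl⟩
      have : 0 < t := ht
      exact Real.lt_sqrt_of_sq_lt (by rw [sq_abs]; nlinarith)
    · intro hr
      have hr : |d| < r := hr
      have hr0 : 0 < r := (abs_nonneg d).trans_lt hr
      have h1 : d ^ 2 < r ^ 2 := by
        rw [← sq_abs d]
        exact pow_lt_pow_left₀ hr (abs_nonneg d) two_ne_zero
      refine ⟨Real.sqrt (r ^ 2 - d ^ 2), Real.sqrt_pos.2 (by linarith), ?_⟩
      simp only
      rw [Real.sq_sqrt (by linarith), add_sub_cancel, Real.sqrt_sq hr0.le]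
  have hder : ∀ t ∈ Ioi (0 : ℝ), HasDerivWithinAt (fun t : ℝ => Real.sqrt (d ^ 2 + t ^ 2))
      (t / Real.sqrt (d ^ 2 + t ^ 2)) (Ioi 0) t := by
    intro t ht
    have h1 : HasDerivAt (fun t : ℝ => d ^ 2 + t ^ 2) (2 * t) t := by
      simpa using (hasDerivAt_pow 2 t).const_add (d ^ 2)
    have h2 := h1.sqrt (hpos t ht).ne'
    rw [mul_div_mul_left _ _ two_ne_zero] at h2
    exact h2.hasDerivWithinAt
  have hchange := integral_image_eq_integral_abs_deriv_smul measurableSet_Ioi hder hinj K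
  rw [himage] at hchange
  calc ∫ t, G t = ∫ t in Ioi (0 : ℝ), (G (-t) + G t) := hsplit
    _ = ∫ t in Ioi (0 : ℝ), |t / Real.sqrt (d ^ 2 + t ^ 2)| • K (Real.sqrt (d ^ 2 + t ^ 2)) := by
        refine setIntegral_congr_fun measurableSet_Ioi fun t ht => ?_
        have ht0 : 0 < t := ht
        have hs := Real.sqrt_pos.2 (hpos t ht)
        simp only [hG, hK, neg_sq]
        by_cases hm : Real.sqrt (d ^ 2 + t ^ 2) ∈ Ioo a b
        · rw [indicator_of_mem hm, indicator_of_mem hm, indicator_of_mem hm,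
            Real.sq_sqrt (hpos t ht).le, add_sub_cancel_left, Real.sqrt_sq ht0.le,
            abs_of_pos (div_pos ht0 hs), Complex.real_smul, neg_div, Complex.ofReal_neg]
          ring
        · simp [indicator_of_notMem hm]
    _ = ∫ r in Ioi |d|, K r := hchange.symm
    -- For `r ≤ |d|` the truncated square root is `0`, so the two terms of `K` cancel and extending
    -- the domain changes nothing.
    _ = ∫ r, K r := by
        rw [← integral_indicator measurableSet_Ioi]
        congr 1
        ext r
        by_cases hr : |d| < r
        · rw [indicator_of_mem (show r ∈ Ioi |d| from hr)]
        · rw [indicator_of_notMem (show r ∉ Ioi |d| from hr)]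
          by_cases hm : r ∈ Ioo a b
          · have h0 : 0 < r := ha.trans hm.1
            have : r ^ 2 - d ^ 2 ≤ 0 := by
              rw [← sq_abs d]
              nlinarith [not_lt.1 hr]
            simp [hK, indicator_of_mem hm, Real.sqrt_eq_zero_of_nonpos this]
          · simp [hK, indicator_of_notMem hm]
    _ = _ := integral_indicator measurableSet_Ioo

theorem hemisphere_integrand_eq_zero (φ : XY n → ℂ) {r : ℝ} {ζ : X n} (h : |r| ≤ ‖ζ‖) :
    φ (pt ζ (Real.sqrt (r ^ 2 - ‖ζ‖ ^ 2))) - φ (pt ζ (-Real.sqrt (r ^ 2 - ‖ζ‖ ^ 2))) = 0 := by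
  have : r ^ 2 - ‖ζ‖ ^ 2 ≤ 0 := by
    rw [← sq_abs r]
    nlinarith [abs_nonneg r]
  simp [Real.sqrt_eq_zero_of_nonpos this]

theorem norm_hemisphere_integrand_le {φ : XY n → ℂ} {M : ℝ} (hM : ∀ p, ‖φ p‖ ≤ M)
    {r b : ℝ} (hr : |r| ≤ b) (ζ : X n) :
    ‖φ (pt ζ (Real.sqrt (r ^ 2 - ‖ζ‖ ^ 2))) - φ (pt ζ (-Real.sqrt (r ^ 2 - ‖ζ‖ ^ 2)))‖ ≤
      (Metric.closedBall (0 : X n) b).indicator (fun _ => 2 * M) ζ := by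
  by_cases h : ζ ∈ Metric.closedBall (0 : X n) b
  · rw [indicator_of_mem h, two_mul]
    exact (norm_sub_le _ _).trans (add_le_add (hM _) (hM _))
  · rw [hemisphere_integrand_eq_zero φ, indicator_of_notMem h, norm_zero]
    rw [mem_closedBall_zero_iff, not_le] at h
    exact hr.trans h.le

theorem integrable_indicator_closedBall (b M : ℝ) :
    Integrable ((Metric.closedBall (0 : X n) b).indicator fun _ => M) := by
  rw [integrable_indicator_iff Metric.isClosed_closedBall.measurableSet]
  exact integrableOn_const (measure_closedBall_lt_top).ne

theorem continuous_hemisphere_integral {φ : XY n → ℂ} (hφ : Continuous φ) {M : ℝ}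
    (hM : ∀ p, ‖φ p‖ ≤ M) :
    Continuous fun r : ℝ => ∫ ζ : X n,
      (φ (pt ζ (Real.sqrt (r ^ 2 - ‖ζ‖ ^ 2))) - φ (pt ζ (-Real.sqrt (r ^ 2 - ‖ζ‖ ^ 2)))) := by
  refine continuous_iff_continuousAt.2 fun r₀ => ?_
  refine continuousAt_of_dominated
    (bound := (Metric.closedBall (0 : X n) (|r₀| + 1)).indicator fun _ => 2 * M) ?_ ?_ ?_ ?_
  · exact Eventually.of_forall fun r => by
      refine Continuous.aestronglyMeasurable ?_
      fun_prop
  · have : ∀ᶠ r in 𝓝 r₀, |r| ≤ |r₀| + 1 :=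
      (continuous_abs.continuousAt.eventually_lt_const (lt_add_one _)).mono fun _ h => le_of_lt h
    filter_upwards [this] with r hr
    exact Eventually.of_forall fun ζ => norm_hemisphere_integrand_le hM hr ζ
  · exact integrable_indicator_closedBall _ _
  · exact Eventually.of_forall fun ζ => by
      refine Continuous.continuousAt ?_
      fun_prop

theorem continuous_sphere_integral {Y : Type*} [TopologicalSpace Y] [FirstCountableTopology Y]
    [LocallyCompactSpace Y] {F : Y → XY n → ℂ} (hF : Continuous (Function.uncurry F)) :
    Continuous fun y : Y => ∫ w : Sph n, F y (w : XY n) ∂(surface n) := by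
  have h := continuous_parametric_integral_of_continuous (μ := surface n)
    (f := fun (y : Y) (w : Sph n) => F y (w : XY n))
    (hF.comp (continuous_fst.prodMk (continuous_subtype_val.comp continuous_snd)))
    (isCompact_univ)
  simpa using h

/-- Surface measure times the height coordinate is the signed projected Lebesgue measure: the upper
hemisphere counts positively, the lower negatively. To avoid parametrising the sphere, integrate
`(p.snd / ‖p‖) φ p` over shells `a < ‖p‖ < b`, once in polar coordinates and once along vertical
lines. The integrand on the right vanishes outside the disc of radius `r`. -/
theorem sphere_integral_snd_mul {φ : XY n → ℂ} (hφ : Continuous φ) {M : ℝ}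
    (hM : ∀ p, ‖φ p‖ ≤ M) {r : ℝ} (hr : 0 < r) :
    (r : ℂ) ^ n * ∫ w : Sph n, ((w : XY n).snd : ℂ) * φ (r • (w : XY n)) ∂(surface n) =
      ∫ ζ : X n,
        (φ (pt ζ (Real.sqrt (r ^ 2 - ‖ζ‖ ^ 2))) - φ (pt ζ (-Real.sqrt (r ^ 2 - ‖ζ‖ ^ 2)))) := by
  set L : ℝ → ℂ := fun r =>
    (r : ℂ) ^ n * ∫ w : Sph n, ((w : XY n).snd : ℂ) * φ (r • (w : XY n)) ∂(surface n)
  set J : ℝ → ℂ := fun r => ∫ ζ : X n,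
    (φ (pt ζ (Real.sqrt (r ^ 2 - ‖ζ‖ ^ 2))) - φ (pt ζ (-Real.sqrt (r ^ 2 - ‖ζ‖ ^ 2))))
  have hL : Continuous L := by
    refine Continuous.mul (by fun_prop) ?_
    exact continuous_sphere_integral (F := fun (r : ℝ) (w : XY n) => (w.snd : ℂ) * φ (r • w))
      (by simp only [Function.uncurry_def]; fun_prop)
  have hJ : Continuous J := continuous_hemisphere_integral hφ hM
  have key : ∀ a b : ℝ, 0 < a → ∫ r in Ioo a b, L r = ∫ r in Ioo a b, J r := by
    intro a b ha
    set F : XY n → ℂ := fun p =>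
      (Ioo a b).indicator (fun r => ((p.snd / r : ℝ) : ℂ) * φ p) ‖p‖ with hF
    have hFbound : ∀ p, ‖F p‖ ≤ (Metric.ball (0 : XY n) b).indicator (fun _ => M) p := by
      intro p
      by_cases hp : ‖p‖ ∈ Ioo a b
      · rw [hF, indicator_of_mem (by simpa using hp.2)]
        simp only [indicator_of_mem hp]
        rw [norm_mul, Complex.norm_real, Real.norm_eq_abs, abs_div, abs_norm]
        have : |p.snd| / ‖p‖ ≤ 1 := div_le_one_of_le₀ (abs_snd_le_norm p) (norm_nonneg _)
        calc |p.snd| / ‖p‖ * ‖φ p‖ ≤ 1 * M := by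
              gcongr
              exact hM p
          _ = M := one_mul M
      · simp only [hF, indicator_of_notMem hp, norm_zero]
        refine indicator_nonneg (fun _ _ => (norm_nonneg _).trans (hM 0)) p
    have hFmeas : Measurable F := by
      have : F = (norm ⁻¹' Ioo a b : Set (XY n)).indicator
          (fun p => ((p.snd / ‖p‖ : ℝ) : ℂ) * φ p) := by
        ext p
        simp only [hF, indicator, mem_preimage]
      rw [this]
      refine Measurable.indicator ?_ (measurableSet_Ioo.preimage measurable_norm)
      have h1 := (continuous_XY_snd (n := n)).measurable
      have h2 := hφ.measurable
      fun_prop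
    have hFint : Integrable F := by
      refine Integrable.mono' (g := (Metric.ball (0 : XY n) b).indicator fun _ => M) ?_
        hFmeas.aestronglyMeasurable (Eventually.of_forall hFbound)
      rw [integrable_indicator_iff measurableSet_ball]
      exact integrableOn_const measure_ball_lt_top.ne
    have hpolar : ∫ p, F p = ∫ r in Ioo a b, L r := by
      rw [integral_eq_integral_polar volume hFint, finrank_XY, Nat.add_sub_cancel,
        ← integral_indicator measurableSet_Ioi, ← integral_indicator measurableSet_Ioo]
      congr 1
      ext r
      by_cases hr : 0 < r
      · rw [indicator_of_mem (show r ∈ Ioi (0 : ℝ) from hr)]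
        have hnorm : ∀ w : Sph n, ‖r • (w : XY n)‖ = r := fun w => by
          rw [norm_smul, norm_eq_of_mem_sphere w, mul_one, Real.norm_of_nonneg hr.le]
        simp only [hF, hnorm]
        by_cases hm : r ∈ Ioo a b
        · simp only [indicator_of_mem hm, L, Complex.real_smul, Complex.ofReal_pow]
          congr 1
          refine integral_congr_ae (Eventually.of_forall fun w => ?_)
          simp only [WithLp.smul_snd, smul_eq_mul, mul_div_cancel_left₀ _ hr.ne']
        · simp [indicator_of_notMem hm]
      · rw [indicator_of_notMem (show r ∉ Ioi (0 : ℝ) from hr), indicator_of_notMem]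
        exact fun h => hr (ha.trans h.1)
    rw [← hpolar, integral_XY_eq hFint]
    have hae : ∀ᵐ x : X n, Integrable fun y : ℝ => F (pt x y) :=
      (integrable_comp_pt_iff.2 hFint).prod_right_ae
    calc ∫ x : X n, ∫ y : ℝ, F (pt x y)
        = ∫ x : X n, ∫ r in Ioo a b, (φ (pt x (Real.sqrt (r ^ 2 - ‖x‖ ^ 2))) -
            φ (pt x (-Real.sqrt (r ^ 2 - ‖x‖ ^ 2)))) := by
          refine integral_congr_ae (hae.mono fun x hx => ?_)
          simp only [hF, norm_pt] at hx ⊢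
          exact integral_hemispheres_aux (fun t => φ (pt x t)) ‖x‖ a b ha hx
      _ = ∫ r in Ioo a b, J r := by
          refine integral_integral_swap ?_
          refine Integrable.mono' (g := fun q : X n × ℝ =>
            (Metric.closedBall (0 : X n) b).indicator (fun _ => 2 * M) q.1 * 1) ?_ ?_ ?_
          · exact (integrable_indicator_closedBall b (2 * M)).mul_prod
              (integrable_const (1 : ℝ))
          · refine Continuous.aestronglyMeasurable ?_
            simp only [Function.uncurry_def]
            fun_prop
          · have : ∀ᵐ q : X n × ℝ ∂(volume.prod (volume.restrict (Ioo a b))), q.2 ∈ Ioo a b :=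
              Measure.quasiMeasurePreserving_snd.ae (ae_restrict_mem measurableSet_Ioo)
            filter_upwards [this] with q hq
            rw [mul_one]
            refine norm_hemisphere_integrand_le hM ?_ q.1
            rw [abs_of_pos (ha.trans hq.1)]
            exact hq.2.le
  -- Both sides are continuous in the radius and have equal integrals over every shell, so
  -- differentiating the primitives from `r / 2` gives equality at `r`.
  have h1 := hL.deriv_integral L (r / 2) r
  have h2 := hJ.deriv_integral J (r / 2) r
  change L r = J r
  rw [← h1, ← h2]
  refine EventuallyEq.deriv_eq ?_
  filter_upwards [Ioi_mem_nhds (half_lt_self hr)] with u hu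
  rw [intervalIntegral.integral_of_le (le_of_lt hu), intervalIntegral.integral_of_le (le_of_lt hu),
    integral_Ioc_eq_integral_Ioo, integral_Ioc_eq_integral_Ioo]
  exact key _ _ (half_pos hr)

end Hemisphere

open RealInnerProductSpace

/-! ### The character `e` and the inverse Fourier transform. -/

section Character

/-- The character `t ↦ exp (2 π i t)`. -/
noncomputable def e (t : ℝ) : ℂ := Complex.exp ((2 * Real.pi * t : ℝ) * Complex.I)

@[simp] theorem norm_e (t : ℝ) : ‖e t‖ = 1 := Complex.norm_exp_ofReal_mul_I _

theorem e_add (s t : ℝ) : e (s + t) = e s * e t := by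
  simp only [e, ← Complex.exp_add]
  congr 1
  push_cast
  ring

@[simp] theorem e_zero : e 0 = 1 := by simp [e]

@[fun_prop] theorem continuous_e : Continuous e := by unfold e; fun_prop

theorem hasDerivAt_e (t : ℝ) : HasDerivAt e (2 * Real.pi * Complex.I * e t) t := by
  have h1 : HasDerivAt (fun t : ℝ => ((2 * Real.pi * t : ℝ) : ℂ) * Complex.I)
      (((2 * Real.pi : ℝ) : ℂ) * Complex.I) t := by
    have := ((hasDerivAt_id t).const_mul (2 * Real.pi)).ofReal_comp.mul_const Complex.I
    simpa using this
  refine h1.cexp.congr_deriv ?_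
  simp only [e]
  push_cast
  ring

theorem e_sub_e_neg (t : ℝ) : e t - e (-t) = 2 * Complex.I * (Real.sin (2 * Real.pi * t) : ℝ) := by
  simp only [e, mul_neg, Complex.exp_mul_I, Complex.ofReal_neg, Complex.cos_neg, Complex.sin_neg,
    Complex.ofReal_sin]
  ring

variable {V : Type*} [NormedAddCommGroup V] [InnerProductSpace ℝ V] [MeasurableSpace V]
  [BorelSpace V] [FiniteDimensional ℝ V]

theorem fourierInv_eq_integral_e (f : V → ℂ) (w : V) : 𝓕⁻ f w = ∫ v, e ⟪v, w⟫ * f v := by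
  rw [Real.fourierInv_eq']
  rfl

theorem integrable_e_mul {α : Type*} [MeasurableSpace α] {μ : Measure α} {f : α → ℂ}
    (hf : Integrable f μ) {u : α → ℝ} (hu : Measurable u) : Integrable (fun a => e (u a) * f a) μ :=
  hf.bdd_mul (continuous_e.measurable.comp hu).aestronglyMeasurable
    (Eventually.of_forall fun _ => (norm_e _).le)

theorem continuous_fourierInv {f : V → ℂ} (hf : Integrable f) : Continuous (𝓕⁻ f) := by
  have : (𝓕⁻ f) = fun w => ∫ v, e ⟪v, w⟫ * f v := funext (fourierInv_eq_integral_e f)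
  rw [this]
  refine continuous_of_dominated (bound := fun v => ‖f v‖) (fun w => ?_) (fun w => ?_) hf.norm ?_
  · exact (integrable_e_mul hf (by fun_prop)).aestronglyMeasurable
  · exact Eventually.of_forall fun v => by simp
  · exact Eventually.of_forall fun v => by fun_prop

theorem norm_fourierInv_le (f : V → ℂ) (w : V) : ‖𝓕⁻ f w‖ ≤ ∫ v, ‖f v‖ := by
  rw [fourierInv_eq_integral_e]
  refine (norm_integral_le_integral_norm _).trans_eq ?_
  simp

end Character

/-! ### Rotation invariance of the surface measure. -/

section Rotation

variable {n : ℕ}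

/-- Extend `F` to the unit ball as a function of direction only. The ball integral is a nonzero
constant times the sphere integral, and Lebesgue measure is invariant under `A`. -/
theorem sphere_integral_isometry (A : XY n ≃ₗᵢ[ℝ] XY n) {F : XY n → ℂ} (hF : Continuous F)
    {M : ℝ} (hM : ∀ p, ‖F p‖ ≤ M) :
    ∫ w : Sph n, F (A w) ∂(surface n) = ∫ w : Sph n, F w ∂(surface n) := by
  have key : ∀ G : XY n → ℂ, Continuous G → (∀ p, ‖G p‖ ≤ M) →
      ∫ p in Metric.ball (0 : XY n) 1, G (‖p‖⁻¹ • p) =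
        (∫ r in Set.Ioo (0 : ℝ) 1, ((r ^ n : ℝ) : ℂ)) * ∫ w : Sph n, G w ∂(surface n) := by
    intro G hG hGM
    have hint : Integrable ((Metric.ball (0 : XY n) 1).indicator fun p => G (‖p‖⁻¹ • p)) := by
      rw [integrable_indicator_iff measurableSet_ball]
      have : IsFiniteMeasure ((volume : Measure (XY n)).restrict (Metric.ball 0 1)) :=
        ⟨by rw [Measure.restrict_apply_univ]; exact measure_ball_lt_top⟩
      refine Integrable.of_bound ?_ M (Eventually.of_forall fun p => hGM _)
      exact (hG.measurable.comp (by fun_prop)).aestronglyMeasurable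
    rw [← integral_indicator measurableSet_ball, integral_eq_integral_polar volume hint, finrank_XY,
      Nat.add_sub_cancel, ← integral_mul_const, ← integral_indicator measurableSet_Ioi,
      ← integral_indicator measurableSet_Ioo]
    congr 1
    ext r
    by_cases hr : 0 < r
    · rw [Set.indicator_of_mem (show r ∈ Set.Ioi (0 : ℝ) from hr)]
      have hnorm : ∀ w : Sph n, ‖r • (w : XY n)‖ = r := fun w => by
        rw [norm_smul, norm_eq_of_mem_sphere w, mul_one, Real.norm_of_nonneg hr.le]
      by_cases h1 : r < 1
      · rw [Set.indicator_of_mem (show r ∈ Set.Ioo (0 : ℝ) 1 from ⟨hr, h1⟩), Complex.real_smul]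
        congr 1
        refine integral_congr_ae (Eventually.of_forall fun w => ?_)
        have : r • (w : XY n) ∈ Metric.ball (0 : XY n) 1 := by simpa [hnorm w] using h1
        simp only [Set.indicator_of_mem this, hnorm w, smul_smul, inv_mul_cancel₀ hr.ne', one_smul]
      · rw [Set.indicator_of_notMem (show r ∉ Set.Ioo (0 : ℝ) 1 from fun h => h1 h.2)]
        have : ∀ w : Sph n, r • (w : XY n) ∉ Metric.ball (0 : XY n) 1 := fun w h => by
          rw [mem_ball_zero_iff, hnorm w] at h
          exact h1 h
        simp [Set.indicator_of_notMem (this _)]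
    · rw [Set.indicator_of_notMem (show r ∉ Set.Ioi (0 : ℝ) from hr),
        Set.indicator_of_notMem (show r ∉ Set.Ioo (0 : ℝ) 1 from fun h => hr h.1)]
  have hball : ∫ p in Metric.ball (0 : XY n) 1, F (A (‖p‖⁻¹ • p)) =
      ∫ p in Metric.ball (0 : XY n) 1, F (‖p‖⁻¹ • p) := by
    rw [← A.measurePreserving.setIntegral_preimage_emb A.toHomeomorph.measurableEmbedding
      (fun p => F (‖p‖⁻¹ • p))]
    have : A ⁻¹' Metric.ball (0 : XY n) 1 = Metric.ball 0 1 := by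
      rw [A.preimage_ball, map_zero]
    simp only [this, A.norm_map, map_smul]
  rw [key (fun p => F (A p)) (hF.comp A.continuous) (fun p => hM _), key F hF hM] at hball
  refine mul_left_cancel₀ ?_ hball
  rw [integral_complex_ofReal, ← integral_Ioc_eq_integral_Ioo,
    ← intervalIntegral.integral_of_le zero_le_one, integral_pow]
  norm_num
  norm_cast

/-- The vectors `‖q‖ • k` and `‖k‖ • q` have the same length, so a reflection carries one to the
other. -/
theorem sphere_integral_e_symm (k q : XY n) :
    ∫ w : Sph n, e (‖q‖ * ⟪k, (w : XY n)⟫) ∂(surface n) =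
      ∫ w : Sph n, e (‖k‖ * ⟪q, (w : XY n)⟫) ∂(surface n) := by
  have hnorm : ‖‖q‖ • k‖ = ‖‖k‖ • q‖ := by
    rw [norm_smul, norm_smul, norm_norm, norm_norm, mul_comm]
  set A := Submodule.reflection (ℝ ∙ (‖q‖ • k - ‖k‖ • q))ᗮ
  have hA : A (‖q‖ • k) = ‖k‖ • q := Submodule.reflection_sub hnorm
  rw [← sphere_integral_isometry A (F := fun w => e (‖k‖ * ⟪q, w⟫)) (by fun_prop)
    (fun p => (norm_e _).le)]
  refine integral_congr_ae (Eventually.of_forall fun w => ?_)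
  simp only
  rw [← real_inner_smul_left, ← real_inner_smul_left, ← hA, A.inner_map_map]

end Rotation

/-! ### Fourier representation of the spherical means and of their `y`-derivative. -/

section SphericalMeanRepresentation

variable {n : ℕ}

theorem inner_pt (v : XY n) (a : X n) (b : ℝ) : ⟪v, pt a b⟫ = ⟪v.fst, a⟫ + v.snd * b := by
  rw [WithLp.prod_inner_apply]
  simp [mul_comm]

theorem inner_XY (v w : XY n) : ⟪v, w⟫ = ⟪v.fst, w.fst⟫ + v.snd * w.snd := by
  rw [WithLp.prod_inner_apply]
  simp [mul_comm]

theorem R_fourierInv {Φ : XY n → ℂ} (hΦ : Integrable Φ) (z : X n) (r : ℝ) :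
    R (𝓕⁻ Φ) z r = ((sphereArea n)⁻¹ : ℝ) * ∫ k, e ⟪k.fst, z⟫ * Φ k *
      ∫ w : Sph n, e (r * ⟪k, (w : XY n)⟫) ∂(surface n) := by
  unfold R
  congr 1
  simp_rw [fourierInv_eq_integral_e]
  rw [integral_integral_swap]
  · refine integral_congr_ae (Eventually.of_forall fun k => ?_)
    simp only
    rw [← integral_const_mul]
    refine integral_congr_ae (Eventually.of_forall fun w => ?_)
    simp only [inner_pt, inner_add_right, real_inner_smul_right]
    rw [inner_XY, ← mul_right_comm, ← e_add]
    congr 2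
    ring
  · exact integrable_e_mul (hΦ.comp_snd (surface n))
      (u := fun q : Sph n × XY n =>
        ⟪q.2, pt (z + r • (q.1 : XY n).fst) (r * (q.1 : XY n).snd)⟫)
      (Continuous.measurable (by fun_prop))

/-- The radius is the norm of `(z - x, t)`, so exchanging it with `‖k‖` makes the phase linear in
`t`. This gives differentiability for every `z`, including `z = x`, `t = 0`, where the square root
is singular. -/
theorem bp_R_fourierInv {Φ : XY n → ℂ} (hΦ : Integrable Φ) (x : X n) (t : ℝ) (z : X n) :
    bp (R (𝓕⁻ Φ)) x t z = ((sphereArea n)⁻¹ : ℝ) * ∫ k, e ⟪k.fst, z⟫ * Φ k *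
      ∫ w : Sph n, e (‖k‖ * (⟪z - x, (w : XY n).fst⟫ + t * (w : XY n).snd)) ∂(surface n) := by
  unfold bp
  rw [R_fourierInv hΦ, ← norm_pt]
  congr 2
  ext k
  rw [sphere_integral_e_symm]
  simp only [inner_XY]
  rfl

theorem norm_sphere_integral_le {F : Sph n → ℂ} {C : ℝ} (hF : ∀ w, ‖F w‖ ≤ C) :
    ‖∫ w, F w ∂(surface n)‖ ≤ C * sphereArea n :=
  norm_integral_le_of_norm_le_const (Eventually.of_forall hF)

theorem abs_snd_sphere_le (w : Sph n) : |(w : XY n).snd| ≤ 1 :=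
  (abs_snd_le_norm _).trans_eq (norm_eq_of_mem_sphere w)

/-- The derivative in `t` of the spherical exponential sum with radius `ρ`. -/
noncomputable def sphereExpDeriv (ρ : ℝ) (a : X n) (t : ℝ) : ℂ :=
  ∫ w : Sph n, 2 * Real.pi * Complex.I * (ρ * (w : XY n).snd) *
    e (ρ * (⟪a, (w : XY n).fst⟫ + t * (w : XY n).snd)) ∂(surface n)

theorem continuous_sphereExpDeriv (a : X n) (t : ℝ) :
    Continuous fun ρ : ℝ => sphereExpDeriv ρ a t :=
  continuous_sphere_integral (F := fun (ρ : ℝ) (w : XY n) =>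
    2 * Real.pi * Complex.I * (ρ * w.snd) * e (ρ * (⟪a, w.fst⟫ + t * w.snd)))
    (by simp only [Function.uncurry_def]; fun_prop)

theorem norm_sphereExpDeriv_integrand_le (ρ : ℝ) (a : X n) (t : ℝ) (w : Sph n) :
    ‖2 * Real.pi * Complex.I * (ρ * (w : XY n).snd) *
      e (ρ * (⟪a, (w : XY n).fst⟫ + t * (w : XY n).snd))‖ ≤ 2 * Real.pi * |ρ| := by
  have h1 : ‖((w : XY n).snd : ℂ)‖ ≤ 1 := by
    rw [Complex.norm_real]
    exact abs_snd_sphere_le w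
  have h2 : ‖(2 * Real.pi * Complex.I : ℂ)‖ = 2 * Real.pi := by
    simp [abs_of_pos Real.pi_pos]
  rw [norm_mul, norm_e, mul_one, norm_mul, h2, norm_mul, Complex.norm_real, Real.norm_eq_abs]
  have := mul_le_mul_of_nonneg_left h1 (abs_nonneg ρ)
  rw [mul_one] at this
  gcongr

theorem norm_sphereExpDeriv_le (ρ : ℝ) (a : X n) (t : ℝ) :
    ‖sphereExpDeriv ρ a t‖ ≤ 2 * Real.pi * |ρ| * sphereArea n :=
  norm_sphere_integral_le (norm_sphereExpDeriv_integrand_le ρ a t)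

theorem hasDerivAt_sphereExp (ρ : ℝ) (a : X n) (t : ℝ) :
    HasDerivAt (fun t : ℝ => ∫ w : Sph n,
      e (ρ * (⟪a, (w : XY n).fst⟫ + t * (w : XY n).snd)) ∂(surface n)) (sphereExpDeriv ρ a t) t := by
  refine (hasDerivAt_integral_of_dominated_loc_of_deriv_le (s := Set.univ)
    (bound := fun _ => 2 * Real.pi * |ρ|)
    (F' := fun t (w : Sph n) => 2 * Real.pi * Complex.I * (ρ * (w : XY n).snd) *
      e (ρ * (⟪a, (w : XY n).fst⟫ + t * (w : XY n).snd)))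
    univ_mem ?_ ?_ ?_ ?_ (integrable_const _) ?_).2
  · refine Eventually.of_forall fun t => Continuous.aestronglyMeasurable (by fun_prop)
  · refine Integrable.of_bound (Continuous.aestronglyMeasurable (by fun_prop)) 1
      (Eventually.of_forall fun w => (norm_e _).le)
  · exact Continuous.aestronglyMeasurable (by fun_prop)
  · exact Eventually.of_forall fun w t _ => norm_sphereExpDeriv_integrand_le ρ a t w
  · refine Eventually.of_forall fun w t _ => ?_
    have h1 : HasDerivAt (fun t : ℝ => ρ * (⟪a, (w : XY n).fst⟫ + t * (w : XY n).snd))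
        (ρ * (w : XY n).snd) t := by
      have := ((hasDerivAt_id t).mul_const (w : XY n).snd).const_add ⟪a, (w : XY n).fst⟫
      simpa using this.const_mul ρ
    refine ((hasDerivAt_e _).scomp t h1).congr_deriv ?_
    rw [Complex.real_smul]
    push_cast
    ring

theorem hasDerivAt_bp_R_fourierInv {Φ : XY n → ℂ} (hΦ : Integrable Φ)
    (hΦ' : Integrable fun k => ‖k‖ * ‖Φ k‖) (x : X n) (y : ℝ) (z : X n) :
    HasDerivAt (fun t : ℝ => bp (R (𝓕⁻ Φ)) x t z)
      (((sphereArea n)⁻¹ : ℝ) * ∫ k, e ⟪k.fst, z⟫ * Φ k * sphereExpDeriv ‖k‖ (z - x) y) y := by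
  have hfun : (fun t : ℝ => bp (R (𝓕⁻ Φ)) x t z) = fun t : ℝ =>
      (((sphereArea n)⁻¹ : ℝ) : ℂ) * ∫ k, e ⟪k.fst, z⟫ * Φ k *
      ∫ w : Sph n, e (‖k‖ * (⟪z - x, (w : XY n).fst⟫ + t * (w : XY n).snd)) ∂(surface n) :=
    funext fun t => bp_R_fourierInv hΦ x t z
  rw [hfun]
  refine HasDerivAt.const_mul _ ?_
  have hmeas : AEStronglyMeasurable (fun k : XY n => e ⟪k.fst, z⟫ * Φ k) :=
    (integrable_e_mul hΦ (u := fun k : XY n => ⟪k.fst, z⟫)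
      (Continuous.measurable (by fun_prop))).aestronglyMeasurable
  have hS : ∀ t : ℝ, Continuous fun k : XY n => ∫ w : Sph n,
      e (‖k‖ * (⟪z - x, (w : XY n).fst⟫ + t * (w : XY n).snd)) ∂(surface n) := fun t =>
    continuous_sphere_integral (F := fun (k : XY n) (w : XY n) =>
      e (‖k‖ * (⟪z - x, w.fst⟫ + t * w.snd))) (by simp only [Function.uncurry_def]; fun_prop)
  refine (hasDerivAt_integral_of_dominated_loc_of_deriv_le (s := Set.univ)
    (bound := fun k => 2 * Real.pi * sphereArea n * (‖k‖ * ‖Φ k‖))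
    (F' := fun t k => e ⟪k.fst, z⟫ * Φ k * sphereExpDeriv ‖k‖ (z - x) t)
    univ_mem ?_ ?_ ?_ ?_ (hΦ'.const_mul _) ?_).2
  · exact Eventually.of_forall fun t => hmeas.mul (hS t).aestronglyMeasurable
  · refine Integrable.mono' (hΦ.norm.mul_const (sphereArea n))
      (hmeas.mul (hS y).aestronglyMeasurable) (Eventually.of_forall fun k => ?_)
    rw [norm_mul, norm_mul, norm_e, one_mul]
    gcongr
    exact (norm_sphere_integral_le fun w => (norm_e _).le).trans_eq (one_mul _)
  · exact hmeas.mul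
      ((continuous_sphereExpDeriv (z - x) y).comp continuous_norm).aestronglyMeasurable
  · refine Eventually.of_forall fun k t _ => ?_
    rw [norm_mul, norm_mul, norm_e, one_mul]
    calc ‖Φ k‖ * ‖sphereExpDeriv ‖k‖ (z - x) t‖
        ≤ ‖Φ k‖ * (2 * Real.pi * |‖k‖| * sphereArea n) := by
          gcongr
          exact norm_sphereExpDeriv_le _ _ _
      _ = _ := by rw [abs_norm]; ring
  · exact Eventually.of_forall fun k t _ => (hasDerivAt_sphereExp ‖k‖ (z - x) t).const_mul _

/-- The height factor produced by differentiation is the weight in `sphere_integral_snd_mul`. The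
two hemispheres have phases with opposite vertical parts, hence the sine. The quotient `ρ / ρ ^ n`
stands for `ρ^(1-n)` and is `0` at `ρ = 0`. -/
theorem sphereExpDeriv_eq {ρ : ℝ} (hρ : 0 ≤ ρ) (a : X n) (t : ℝ) :
    sphereExpDeriv ρ a t = -(4 * Real.pi : ℝ) * ((ρ / ρ ^ n : ℝ) : ℂ) *
      ∫ ζ : X n, e ⟪ζ, a⟫ * (Real.sin (2 * Real.pi * (t * Real.sqrt (ρ ^ 2 - ‖ζ‖ ^ 2))) : ℝ) := by
  rcases hρ.eq_or_lt with rfl | hρ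
  · simp [sphereExpDeriv]
  have h := sphere_integral_snd_mul (n := n) (φ := fun p => e (⟪p.fst, a⟫ + t * p.snd))
    (by fun_prop) (M := 1) (fun p => (norm_e _).le) hρ
  have h1 : sphereExpDeriv ρ a t = 2 * Real.pi * Complex.I * ρ *
      ∫ w : Sph n, ((w : XY n).snd : ℂ) *
        e (⟪(ρ • (w : XY n)).fst, a⟫ + t * (ρ • (w : XY n)).snd) ∂(surface n) := by
    unfold sphereExpDeriv
    rw [← integral_const_mul]
    refine integral_congr_ae (Eventually.of_forall fun w => ?_)
    simp only [WithLp.smul_fst, WithLp.smul_snd, real_inner_smul_left, smul_eq_mul]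
    rw [real_inner_comm a]
    have : ρ * (⟪a, (w : XY n).fst⟫ + t * (w : XY n).snd) =
        ρ * ⟪a, (w : XY n).fst⟫ + t * (ρ * (w : XY n).snd) := by ring
    rw [this]
    ring
  have h2 : (∫ ζ : X n, (e (⟪ζ, a⟫ + t * Real.sqrt (ρ ^ 2 - ‖ζ‖ ^ 2)) -
      e (⟪ζ, a⟫ + t * -Real.sqrt (ρ ^ 2 - ‖ζ‖ ^ 2)))) = 2 * Complex.I * ∫ ζ : X n, e ⟪ζ, a⟫ *
        (Real.sin (2 * Real.pi * (t * Real.sqrt (ρ ^ 2 - ‖ζ‖ ^ 2))) : ℝ) := by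
    rw [← integral_const_mul]
    refine integral_congr_ae (Eventually.of_forall fun ζ => ?_)
    simp only [e_add, mul_neg]
    rw [← mul_sub, e_sub_e_neg]
    ring
  replace h := h.trans h2
  have hρn : (ρ : ℂ) ^ n ≠ 0 := pow_ne_zero _ (by exact_mod_cast hρ.ne')
  rw [h1, ← mul_right_inj' hρn]
  calc _ = 2 * Real.pi * Complex.I * ρ * ((ρ : ℂ) ^ n * ∫ w : Sph n, ((w : XY n).snd : ℂ) *
        e (⟪(ρ • (w : XY n)).fst, a⟫ + t * (ρ • (w : XY n)).snd) ∂(surface n)) := by ring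
    _ = 2 * Real.pi * Complex.I * ρ * (2 * Complex.I * ∫ ζ : X n, e ⟪ζ, a⟫ *
        (Real.sin (2 * Real.pi * (t * Real.sqrt (ρ ^ 2 - ‖ζ‖ ^ 2))) : ℝ)) := by rw [h]
    _ = _ := by
        push_cast
        field_simp
        rw [Complex.I_sq]
        ring

end SphericalMeanRepresentation

/-! ### Integrability of the radial weight `‖k‖^(1-n)` against Schwartz functions. -/

section Weights

variable {n : ℕ}

theorem exists_one_add_norm_pow_mul_le (g : 𝓢(XY n, ℂ)) (m : ℕ) :
    ∃ C, ∀ k, (1 + ‖k‖) ^ m * ‖g k‖ ≤ C := by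
  refine ⟨2 ^ m * (Finset.Iic (m, 0)).sup (fun m => SchwartzMap.seminorm ℝ m.1 m.2) g,
    fun k => ?_⟩
  have := SchwartzMap.one_add_le_sup_seminorm_apply (𝕜 := ℝ) (m := (m, 0)) (k := m) (n := 0)
    le_rfl le_rfl g k
  simpa using this

/-- In dimension `n + 1` the polar Jacobian `r ^ n` cancels the singularity at the origin, leaving
`r / (1 + r) ^ 3`. -/
theorem integrable_radial_weight :
    Integrable fun k : XY n => ‖k‖ / ‖k‖ ^ n * ((1 + ‖k‖) ^ 3)⁻¹ := by
  rw [integrable_fun_norm_addHaar volume (f := fun r : ℝ => r / r ^ n * ((1 + r) ^ 3)⁻¹), finrank_XY,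
    Nat.add_sub_cancel]
  have h : Integrable fun r : ℝ => (1 + ‖r‖) ^ (-2 : ℝ) := integrable_one_add_norm (by simp)
  refine Integrable.mono' h.integrableOn ?_ ?_
  · exact Measurable.aestronglyMeasurable (by fun_prop)
  · filter_upwards [ae_restrict_mem measurableSet_Ioi] with r hr
    have hr : 0 < r := hr
    have h1 : r ^ n • (r / r ^ n * ((1 + r) ^ 3)⁻¹) = r / (1 + r) ^ 3 := by
      rw [smul_eq_mul]
      field_simp
    rw [h1, Real.norm_of_nonneg (by positivity), Real.norm_of_nonneg hr.le,
      Real.rpow_neg (by positivity)]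
    have h2 : (1 + r) ^ (2 : ℝ) = (1 + r) ^ 2 := by exact_mod_cast Real.rpow_natCast (1 + r) 2
    rw [h2, inv_eq_one_div, div_le_div_iff₀ (by positivity) (by positivity)]
    nlinarith [sq_nonneg (1 + r), sq_nonneg r]

theorem integrable_weight_mul (g : 𝓢(XY n, ℂ)) (m : ℕ) :
    Integrable fun k => (1 + ‖k‖) ^ m * ‖((‖k‖ / ‖k‖ ^ n : ℝ) : ℂ) * g k‖ := by
  obtain ⟨C, hC⟩ := exists_one_add_norm_pow_mul_le g (m + 3)
  refine Integrable.mono' (integrable_radial_weight.mul_const C) ?_ (Eventually.of_forall fun k => ?_)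
  · have := g.continuous.measurable
    exact Measurable.aestronglyMeasurable (by fun_prop)
  · rw [Real.norm_of_nonneg (by positivity), norm_mul, Complex.norm_real,
      Real.norm_of_nonneg (by positivity)]
    calc (1 + ‖k‖) ^ m * (‖k‖ / ‖k‖ ^ n * ‖g k‖)
        = ‖k‖ / ‖k‖ ^ n * ((1 + ‖k‖) ^ 3)⁻¹ * ((1 + ‖k‖) ^ (m + 3) * ‖g k‖) := by
          rw [pow_add]
          field_simp
      _ ≤ _ := by gcongr; exact hC k

theorem integrable_of_weight {G : XY n → ℂ} (hGm : AEStronglyMeasurable G) {m : ℕ}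
    (hG : Integrable fun k => (1 + ‖k‖) ^ m * ‖G k‖) : Integrable G := by
  refine Integrable.mono' hG hGm (Eventually.of_forall fun k => ?_)
  refine le_mul_of_one_le_left (norm_nonneg _) (one_le_pow₀ ?_)
  linarith [norm_nonneg k]

end Weights

/-! ### The profile, whose inverse Fourier transform is the backprojection integrand up to a
constant. -/

section Profile

variable {n : ℕ}

/-- The kernel `sin (2 π y √(‖k‖² - ‖ζ‖²))`. -/
noncomputable def sineKernel (y : ℝ) (k : XY n) (ζ : X n) : ℝ :=
  Real.sin (2 * Real.pi * (y * Real.sqrt (‖k‖ ^ 2 - ‖ζ‖ ^ 2)))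

theorem abs_sineKernel_le_one (y : ℝ) (k : XY n) (ζ : X n) : |sineKernel y k ζ| ≤ 1 :=
  Real.abs_sin_le_one _

/-- The kernel vanishes unless `‖ζ - k.fst‖ < ‖k‖`, which forces `1 + ‖ζ‖ ≤ 2 (1 + ‖k‖)`. Polynomial
growth in `k`, harmless against rapidly decaying `g`, buys decay in `ζ` of order `n + 1`, integrable
on `ℝⁿ`. -/
theorem abs_sineKernel_sub_le (y : ℝ) (k : XY n) (ζ : X n) :
    |sineKernel y k (ζ - k.fst)| ≤
      (2 * (1 + ‖k‖)) ^ (n + 1) * (1 + ‖ζ‖) ^ (-((n + 1 : ℕ) : ℝ)) := by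
  rw [Real.rpow_neg (by positivity), Real.rpow_natCast]
  by_cases h : ‖ζ - k.fst‖ < ‖k‖
  · have h1 : 1 + ‖ζ‖ ≤ 2 * (1 + ‖k‖) := by
      have := norm_sub_norm_le ζ k.fst
      linarith [norm_fst_le_norm k, norm_nonneg k]
    refine (abs_sineKernel_le_one _ _ _).trans ?_
    rw [← div_eq_mul_inv, one_le_div (by positivity)]
    gcongr
  · have h1 : ‖k‖ ^ 2 - ‖ζ - k.fst‖ ^ 2 ≤ 0 := by
      have := pow_le_pow_left₀ (norm_nonneg _) (not_lt.1 h) 2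
      linarith
    rw [sineKernel, Real.sqrt_eq_zero_of_nonpos h1]
    simp only [mul_zero, Real.sin_zero, abs_zero]
    positivity

/-- The function of `ζ` whose inverse Fourier transform is the backprojection integrand. -/
noncomputable def profile (G : XY n → ℂ) (y : ℝ) (ζ : X n) : ℂ :=
  ∫ k, G k * (sineKernel y k (ζ - k.fst) : ℝ)

/-- The value needed when integrating over all centres: at `ζ = 0` the radicand is `‖k‖² - ‖k.fst‖²
= k.snd²`. -/
theorem profile_zero (G : XY n → ℂ) (y : ℝ) :
    profile G y 0 = ∫ k, G k * (Real.sin (2 * Real.pi * (y * |k.snd|)) : ℝ) := by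
  unfold profile sineKernel
  congr 1
  ext k
  have h : ‖k‖ ^ 2 = ‖k.fst‖ ^ 2 + ‖k.snd‖ ^ 2 := WithLp.prod_norm_sq_eq_of_L2 k
  rw [zero_sub, norm_neg, h, add_sub_cancel_left, Real.norm_eq_abs, Real.sqrt_sq (abs_nonneg _)]

theorem continuous_profile {G : XY n → ℂ} (hG : Integrable G) (y : ℝ) :
    Continuous (profile G y) := by
  refine continuous_of_dominated (bound := fun k => ‖G k‖) (fun ζ => ?_) (fun ζ => ?_) hG.norm ?_
  · refine hG.aestronglyMeasurable.mul (Continuous.aestronglyMeasurable ?_)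
    unfold sineKernel
    fun_prop
  · refine Eventually.of_forall fun k => ?_
    rw [norm_mul, Complex.norm_real, Real.norm_eq_abs]
    exact mul_le_of_le_one_right (norm_nonneg _) (abs_sineKernel_le_one _ _ _)
  · refine Eventually.of_forall fun k => ?_
    unfold sineKernel
    fun_prop

theorem integrable_profile_kernel {G : XY n → ℂ} (hGm : AEStronglyMeasurable G)
    (hG : Integrable fun k => (1 + ‖k‖) ^ (n + 1) * ‖G k‖) (y : ℝ) :
    Integrable (fun q : X n × XY n => G q.2 * (sineKernel y q.2 (q.1 - q.2.fst) : ℝ))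
      (volume.prod volume) := by
  have h1 : Integrable fun ζ : X n => (1 + ‖ζ‖) ^ (-((n + 1 : ℕ) : ℝ)) :=
    integrable_one_add_norm (by simp)
  refine Integrable.mono' ((h1.mul_prod hG).const_mul (2 ^ (n + 1))) ?_
    (Eventually.of_forall fun q => ?_)
  · refine hGm.comp_snd.mul (Continuous.aestronglyMeasurable ?_)
    unfold sineKernel
    fun_prop
  · rw [norm_mul, Complex.norm_real, Real.norm_eq_abs]
    refine (mul_le_mul_of_nonneg_left (abs_sineKernel_sub_le y q.2 q.1) (norm_nonneg _)).trans_eq ?_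
    rw [mul_pow]
    ring

theorem integrable_profile {G : XY n → ℂ} (hGm : AEStronglyMeasurable G)
    (hG : Integrable fun k => (1 + ‖k‖) ^ (n + 1) * ‖G k‖) (y : ℝ) :
    Integrable (profile G y) :=
  (integrable_profile_kernel hGm hG y).integral_prod_left

/-- Fubini, followed by the translation of `ζ` by `k.fst`, which produces the extra character. -/
theorem fourierInv_profile {G : XY n → ℂ} (hGm : AEStronglyMeasurable G)
    (hG : Integrable fun k => (1 + ‖k‖) ^ (n + 1) * ‖G k‖) (y : ℝ) (a : X n) :
    𝓕⁻ (profile G y) a = ∫ k, G k * e ⟪k.fst, a⟫ *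
      ∫ ζ : X n, e ⟪ζ, a⟫ * (sineKernel y k ζ : ℝ) := by
  rw [fourierInv_eq_integral_e]
  unfold profile
  simp_rw [← integral_const_mul]
  rw [integral_integral_swap]
  · refine integral_congr_ae (Eventually.of_forall fun k => ?_)
    simp only
    rw [← integral_sub_right_eq_self (fun ζ => G k * e ⟪k.fst, a⟫ *
      (e ⟪ζ, a⟫ * ((sineKernel y k ζ : ℝ) : ℂ))) k.fst]
    refine integral_congr_ae (Eventually.of_forall fun ζ => ?_)
    simp only
    have : e ⟪ζ, a⟫ = e ⟪k.fst, a⟫ * e ⟪ζ - k.fst, a⟫ := by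
      rw [← e_add, ← inner_add_left, add_sub_cancel]
    rw [this]
    ring
  · exact integrable_e_mul (integrable_profile_kernel hGm hG y)
      (u := fun q : X n × XY n => ⟪q.1, a⟫) (by fun_prop)

end Profile

/-! ### Integration over the centres by Fourier inversion. -/

section BackprojectionFormula

variable {n : ℕ}

theorem sphereArea_pos : 0 < sphereArea n := by
  have : surface n ≠ 0 := Measure.toSphere_ne_zero _
  have h : sphereArea n ≠ 0 := by
    simpa [sphereArea, measureReal_def, ENNReal.toReal_eq_zero_iff] using this
  exact measureReal_nonneg.lt_of_ne' h

theorem schwartz_integrable_norm_mul (g : 𝓢(XY n, ℂ)) : Integrable fun k => ‖k‖ * ‖g k‖ := by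
  simpa using g.integrable_pow_mul volume 1

theorem deriv_bp_eq_fourierInv (g : 𝓢(XY n, ℂ)) (x : X n) (y : ℝ) (z : X n) :
    deriv (fun t : ℝ => bp (R (𝓕⁻ (g : XY n → ℂ))) x t z) y =
      ((-(4 * Real.pi) * (sphereArea n)⁻¹ : ℝ) : ℂ) *
        𝓕⁻ (profile (fun k => e ⟪k.fst, x⟫ * (((‖k‖ / ‖k‖ ^ n : ℝ) : ℂ) * g k)) y) (z - x) := by
  rw [(hasDerivAt_bp_R_fourierInv g.integrable (schwartz_integrable_norm_mul g) x y z).deriv,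
    fourierInv_profile]
  · simp_rw [sphereExpDeriv_eq (norm_nonneg _)]
    rw [← integral_const_mul, ← integral_const_mul]
    refine integral_congr_ae (Eventually.of_forall fun k => ?_)
    simp only [sineKernel]
    have : e ⟪k.fst, z⟫ = e ⟪k.fst, x⟫ * e ⟪k.fst, z - x⟫ := by
      rw [← e_add, ← inner_add_right, add_sub_cancel]
    rw [this]
    push_cast
    ring
  · have := g.continuous.measurable
    exact Measurable.aestronglyMeasurable (by fun_prop)
  · simpa using integrable_weight_mul g (n + 1)

/-- The integral of `𝓕⁻ (profile G y)` is its Fourier transform at `0`. By inversion for continuous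
integrable functions with integrable transform, this is `profile G y 0`. The hypothesis `h` supplies
the integrable transform. -/
theorem modBackproj_eq_of_integrable (g : 𝓢(XY n, ℂ)) (x : X n) (y : ℝ)
    (h : Integrable fun z => deriv (fun t : ℝ => bp (R (𝓕⁻ (g : XY n → ℂ))) x t z) y) :
    modBackproj (R (𝓕⁻ (g : XY n → ℂ))) (pt x y) =
      ((-(4 * Real.pi) * (sphereArea n)⁻¹ : ℝ) : ℂ) *
        ∫ k, e ⟪k.fst, x⟫ * (((‖k‖ / ‖k‖ ^ n : ℝ) : ℂ) * g k) *
          (Real.sin (2 * Real.pi * (y * |k.snd|)) : ℝ) := by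
  set G : XY n → ℂ := fun k => e ⟪k.fst, x⟫ * (((‖k‖ / ‖k‖ ^ n : ℝ) : ℂ) * g k) with hG
  have hGm : AEStronglyMeasurable G := by
    have := g.continuous.measurable
    exact Measurable.aestronglyMeasurable (by fun_prop)
  have hGi : Integrable fun k => (1 + ‖k‖) ^ (n + 1) * ‖G k‖ := by
    simpa [hG] using integrable_weight_mul g (n + 1)
  have hA : sphereArea n ≠ 0 := sphereArea_pos.ne'
  have hC : ((-(4 * Real.pi) * (sphereArea n)⁻¹ : ℝ) : ℂ) ≠ 0 := by
    have : -(4 * Real.pi) * (sphereArea n)⁻¹ ≠ 0 :=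
      mul_ne_zero (neg_ne_zero.2 (mul_ne_zero four_ne_zero Real.pi_ne_zero)) (inv_ne_zero hA)
    exact_mod_cast this
  have hd : ∀ z, deriv (fun t : ℝ => bp (R (𝓕⁻ (g : XY n → ℂ))) x t z) y =
      ((-(4 * Real.pi) * (sphereArea n)⁻¹ : ℝ) : ℂ) * 𝓕⁻ (profile G y) (z - x) :=
    deriv_bp_eq_fourierInv g x y
  change ∫ z, deriv (fun t : ℝ => bp (R (𝓕⁻ (g : XY n → ℂ))) x t z) y = _
  simp only [hd] at h ⊢
  rw [integral_const_mul, ← profile_zero G y]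
  congr 1
  have h1 : Integrable (𝓕⁻ (profile G y)) := by
    have h2 := (integrable_const_mul_iff hC.isUnit _).1 h
    have h3 := h2.comp_add_right x
    simp only [add_sub_cancel_right] at h3
    exact h3
  have h3 := (continuous_profile (integrable_of_weight hGm hGi) y).fourier_fourierInv_eq
    (integrable_profile hGm hGi y)
  rw [integral_sub_right_eq_self (𝓕⁻ (profile G y)) x]
  have h4 : Integrable (𝓕 (profile G y)) := by
    have := h1.comp_neg
    simpa [Real.fourierInv_eq_fourier_neg] using this
  have h5 := congrFun (h3 h4) 0
  rw [← h5, Real.fourier_eq]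
  simp

end BackprojectionFormula

/-! ### Absolute convergence of the modified backprojection. -/

section Decay

variable {n : ℕ}

theorem pt_add_smul (z : X n) (r : ℝ) (w : XY n) :
    pt (z + r • w.fst) (r * w.snd) = pt z 0 + r • w := by
  apply WithLp.ofLp_injective
  ext <;> simp

theorem integrable_sphere {F : Sph n → ℂ} (hF : Continuous F) : Integrable F (surface n) :=
  hF.integrable_of_hasCompactSupport (HasCompactSupport.of_compactSpace F)

/-- The two integrands differ by at most `K |r - s|`, and only in directions where one of the two
spheres meets the ball containing the support. Each such set of directions has measure `O(d^(-n))`.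
-/
theorem norm_R_sub_R_le {f : XY n → ℂ} {K : NNReal} (hK : LipschitzWith K f) {A : ℝ}
    (hA : ∀ p, A ≤ ‖p‖ → f p = 0) (z : X n) {d r s : ℝ} (hd : 0 < d) (hr : d ≤ r) (hs : d ≤ s) :
    ‖R f z r - R f z s‖ ≤ (sphereArea n)⁻¹ *
      (K * |r - s| * (2 * (volume.real (Metric.ball (0 : XY n) (A + 1)) / d ^ n))) := by
  have hcont : ∀ r : ℝ, Integrable (fun w : Sph n =>
      f (pt (z + r • (w : XY n).fst) (r * (w : XY n).snd))) (surface n) := fun r =>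
    integrable_sphere (hK.continuous.comp (by fun_prop))
  unfold R
  rw [← mul_sub, ← integral_sub (hcont r) (hcont s), norm_mul, Complex.norm_real,
    Real.norm_of_nonneg (inv_nonneg.2 sphereArea_pos.le)]
  refine mul_le_mul_of_nonneg_left ?_ (inv_nonneg.2 sphereArea_pos.le)
  set T : ℝ → Set (Sph n) := fun r => {w | r • (w : XY n) ∈ Metric.ball (-pt z 0) A} with hT
  have hTm : ∀ r, MeasurableSet (T r) := fun r => measurableSet_ball.preimage (by fun_prop)
  have hTle : ∀ r, d ≤ r → (surface n).real (T r) ≤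
      volume.real (Metric.ball (0 : XY n) (A + 1)) / d ^ n := by
    intro r hr
    refine (toSphere_smul_mem_ball_le volume (-pt z 0) (hd.trans_le hr)).trans ?_
    rw [finrank_XY, Nat.add_sub_cancel]
    gcongr
  have hzero : ∀ r, ∀ w : Sph n, w ∉ T r → f (pt z 0 + r • (w : XY n)) = 0 := by
    intro r w hw
    refine hA _ (not_lt.1 fun h => hw ?_)
    rw [hT, Set.mem_ofPred_eq, mem_ball_iff_norm, sub_neg_eq_add, add_comm]
    exact h
  have hpoint : ∀ w : Sph n, ‖f (pt (z + r • (w : XY n).fst) (r * (w : XY n).snd)) -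
      f (pt (z + s • (w : XY n).fst) (s * (w : XY n).snd))‖ ≤
      (T r ∪ T s).indicator (fun _ => K * |r - s|) w := by
    intro w
    rw [pt_add_smul, pt_add_smul]
    by_cases hw : w ∈ T r ∪ T s
    · rw [Set.indicator_of_mem hw, ← dist_eq_norm]
      refine (hK.dist_le_mul _ _).trans_eq ?_
      rw [dist_add_left, dist_smul_sphere]
    · rw [Set.indicator_of_notMem hw, hzero r w fun h => hw (Or.inl h),
        hzero s w fun h => hw (Or.inr h), sub_zero, norm_zero]
  refine (norm_integral_le_of_norm_le
    ((integrable_const _).indicator ((hTm r).union (hTm s))) (Eventually.of_forall hpoint)).trans ?_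
  rw [integral_indicator_const _ ((hTm r).union (hTm s)), smul_eq_mul, mul_comm]
  refine mul_le_mul_of_nonneg_left ?_ (by positivity)
  rw [two_mul]
  exact (measureReal_union_le _ _).trans (add_le_add (hTle r hr) (hTle s hs))

/-- One more power of `‖z - x‖` is gained over `norm_R_sub_R_le`, since the difference of two radii
`√(d² + t²)`, `√(d² + y²)` is `|t - y| |t + y|` divided by their sum, which is at least `2 d`. -/
theorem norm_deriv_bp_R_le {f : XY n → ℂ} {K : NNReal} (hK : LipschitzWith K f) {A : ℝ}
    (hA : ∀ p, A ≤ ‖p‖ → f p = 0) (x : X n) (y : ℝ) :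
    ∃ C, 0 ≤ C ∧ ∀ z : X n, z ≠ x →
      ‖deriv (fun t : ℝ => bp (R f) x t z) y‖ ≤ C / ‖z - x‖ ^ (n + 1) := by
  set B := volume.real (Metric.ball (0 : XY n) (A + 1))
  have hB : 0 ≤ B := measureReal_nonneg
  have hS := sphereArea_pos (n := n)
  refine ⟨(sphereArea n)⁻¹ * (K * (2 * |y| + 1) * B), by positivity, fun z hz => ?_⟩
  set d := ‖z - x‖
  have hd : 0 < d := norm_pos_iff.2 (sub_ne_zero.2 hz)
  refine norm_deriv_le_of_lip' (by positivity) ?_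
  filter_upwards [Metric.ball_mem_nhds y one_pos] with t ht
  have hle : ∀ t : ℝ, d ≤ Real.sqrt (d ^ 2 + t ^ 2) := fun t =>
    Real.le_sqrt_of_sq_le (by nlinarith [sq_nonneg t])
  have hsq : ∀ t : ℝ, Real.sqrt (d ^ 2 + t ^ 2) ^ 2 = d ^ 2 + t ^ 2 := fun t =>
    Real.sq_sqrt (by positivity)
  have hdiff : |Real.sqrt (d ^ 2 + t ^ 2) - Real.sqrt (d ^ 2 + y ^ 2)| ≤
      |t - y| * (2 * |y| + 1) / (2 * d) := by
    rw [le_div_iff₀ (by positivity)]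
    have h1 : |Real.sqrt (d ^ 2 + t ^ 2) - Real.sqrt (d ^ 2 + y ^ 2)| *
        (Real.sqrt (d ^ 2 + t ^ 2) + Real.sqrt (d ^ 2 + y ^ 2)) = |t - y| * |t + y| := by
      rw [← abs_of_nonneg (a := Real.sqrt (d ^ 2 + t ^ 2) + Real.sqrt (d ^ 2 + y ^ 2))
        (by positivity), ← abs_mul, ← abs_mul]
      congr 1
      linear_combination hsq t - hsq y
    have h2 : |t + y| ≤ 2 * |y| + 1 := by
      have h3 : |t - y| < 1 := by simpa [Real.dist_eq] using ht
      calc |t + y| = |(t - y) + 2 * y| := by ring_nf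
        _ ≤ |t - y| + |2 * y| := abs_add_le _ _
        _ ≤ 2 * |y| + 1 := by rw [abs_mul, abs_two]; linarith
    calc _ ≤ |Real.sqrt (d ^ 2 + t ^ 2) - Real.sqrt (d ^ 2 + y ^ 2)| *
        (Real.sqrt (d ^ 2 + t ^ 2) + Real.sqrt (d ^ 2 + y ^ 2)) := by
          gcongr
          linarith [hle t, hle y]
      _ ≤ _ := by rw [h1]; gcongr
  refine (norm_R_sub_R_le hK hA z hd (hle t) (hle y)).trans ?_
  calc (sphereArea n)⁻¹ * (K * |Real.sqrt (d ^ 2 + t ^ 2) - Real.sqrt (d ^ 2 + y ^ 2)| *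
        (2 * (B / d ^ n)))
      ≤ (sphereArea n)⁻¹ * (K * (|t - y| * (2 * |y| + 1) / (2 * d)) * (2 * (B / d ^ n))) := by
        gcongr
    _ = _ := by
        rw [Real.norm_eq_abs, pow_succ]
        field_simp

theorem integrable_deriv_bp (g : 𝓢(XY n, ℂ)) {f : XY n → ℂ} (hfg : f = 𝓕⁻ (g : XY n → ℂ))
    {K : NNReal} (hK : LipschitzWith K f) {A : ℝ} (hA : ∀ p, A ≤ ‖p‖ → f p = 0)
    (x : X n) (y : ℝ) : Integrable fun z => deriv (fun t : ℝ => bp (R f) x t z) y := by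
  obtain ⟨C, hC0, hC⟩ := norm_deriv_bp_R_le hK hA x y
  set G : XY n → ℂ := fun k => e ⟪k.fst, x⟫ * (((‖k‖ / ‖k‖ ^ n : ℝ) : ℂ) * g k) with hG
  have hGm : AEStronglyMeasurable G := by
    have := g.continuous.measurable
    exact Measurable.aestronglyMeasurable (by fun_prop)
  have hGi : Integrable fun k => (1 + ‖k‖) ^ (n + 1) * ‖G k‖ := by
    simpa [hG] using integrable_weight_mul g (n + 1)
  set c₀ : ℂ := ((-(4 * Real.pi) * (sphereArea n)⁻¹ : ℝ) : ℂ)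
  have hd : ∀ z, deriv (fun t : ℝ => bp (R f) x t z) y = c₀ * 𝓕⁻ (profile G y) (z - x) := by
    rw [hfg]
    exact deriv_bp_eq_fourierInv g x y
  have hpi := integrable_profile hGm hGi y
  set D := ‖c₀‖ * ∫ ζ, ‖profile G y ζ‖
  have hD0 : 0 ≤ D := mul_nonneg (norm_nonneg _) (integral_nonneg fun _ => norm_nonneg _)
  have hD : ∀ z, ‖deriv (fun t : ℝ => bp (R f) x t z) y‖ ≤ D := fun z => by
    rw [hd, norm_mul]
    exact mul_le_mul_of_nonneg_left (norm_fourierInv_le _ _) (norm_nonneg _)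
  have h1 : Integrable fun ζ : X n => (1 + ‖ζ‖) ^ (-((n + 1 : ℕ) : ℝ)) :=
    integrable_one_add_norm (by simp)
  -- `C` handles `‖z - x‖ ≥ 1`, where `1 + ‖z - x‖ ≤ 2 ‖z - x‖`; the uniform bound `D` handles the
  -- rest, where `1 + ‖z - x‖ ≤ 2`.
  refine Integrable.mono' ((h1.comp_sub_right x).const_mul (2 ^ (n + 1) * (C + D))) ?_
    (Eventually.of_forall fun z => ?_)
  · simp only [hd]
    have := continuous_fourierInv hpi
    exact Continuous.aestronglyMeasurable (by fun_prop)
  · rw [Real.rpow_neg (by positivity), Real.rpow_natCast, ← div_eq_mul_inv,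
      le_div_iff₀ (by positivity)]
    rcases le_or_gt 1 ‖z - x‖ with h | h
    · have hz : z ≠ x := by
        rintro rfl
        simp at h
        linarith
      have hpos : 0 < ‖z - x‖ := by linarith
      calc _ ≤ C / ‖z - x‖ ^ (n + 1) * (2 * ‖z - x‖) ^ (n + 1) := by
            gcongr
            · exact hC z hz
            · linarith
        _ = 2 ^ (n + 1) * C := by
            rw [mul_pow]
            field_simp
        _ ≤ _ := by gcongr; linarith
    · calc _ ≤ D * 2 ^ (n + 1) := by
            gcongr
            · exact hD z
            · linarith
        _ ≤ _ := by
            rw [mul_comm]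
            gcongr
            linarith

end Decay

/-! ### Divergence of the unmodified backprojection. -/

section Divergence

variable {n : ℕ}

/-- In polar coordinates the integrand exceeds a multiple of `1 / r` once `r > B`, so the divergence
is logarithmic. -/
theorem not_integrable_inv_norm_add_pow (hn : 1 ≤ n) {B : ℝ} (hB : 0 < B) :
    ¬ Integrable fun z : X n => ((‖z‖ + B) ^ n)⁻¹ := by
  intro h
  have : Nonempty (Fin n) := ⟨⟨0, hn⟩⟩
  have hfin : Module.finrank ℝ (X n) = n := by simp
  rw [integrable_fun_norm_addHaar volume (f := fun r : ℝ => ((r + B) ^ n)⁻¹), hfin] at h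
  refine not_integrableOn_Ioi_inv (a := B) ?_
  have h2 : IntegrableOn (fun r : ℝ => 2 ^ n * (r ^ (n - 1) • ((r + B) ^ n)⁻¹)) (Set.Ioi B) :=
    (h.mono_set (Set.Ioi_subset_Ioi hB.le)).const_mul _
  refine Integrable.mono' h2 measurable_inv.aestronglyMeasurable ?_
  filter_upwards [ae_restrict_mem measurableSet_Ioi] with r hr
  have hr : B < r := hr
  have hr0 : 0 < r := hB.trans hr
  rw [Real.norm_of_nonneg (by positivity), smul_eq_mul, ← div_eq_mul_inv, mul_div_assoc',
    le_div_iff₀ (by positivity)]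
  calc r⁻¹ * (r + B) ^ n ≤ r⁻¹ * (2 * r) ^ n := by
        gcongr
        linarith
    _ = 2 ^ n * (r⁻¹ * r ^ n) := by rw [mul_pow]; ring
    _ = 2 ^ n * r ^ (n - 1) := by
        obtain ⟨m, rfl⟩ := Nat.exists_eq_add_of_le' hn
        rw [Nat.add_sub_cancel, pow_succ r m]
        field_simp

/-- The sphere centred at `z` passes through `(x, y)`. Near that point `f` exceeds half its value
there, on a set of directions of measure at least a constant times `(‖z - x‖ + B)^(-n)`. -/
theorem not_integrable_bp (hn : 1 ≤ n) {f : XY n → ℂ} (hf : Continuous f)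
    (hpos : ∀ p : XY n, ∃ a : ℝ, 0 ≤ a ∧ f p = (a : ℂ)) (x : X n) (y : ℝ) (hxy : f (pt x y) ≠ 0) :
    ¬ Integrable fun z : X n => bp (R f) x y z := by
  intro h
  have hnn : ∀ p, 0 ≤ (f p).re := fun p => by
    obtain ⟨a, ha, hp⟩ := hpos p
    simpa [hp] using ha
  have hp : 0 < (f (pt x y)).re := by
    obtain ⟨a, ha, hp⟩ := hpos (pt x y)
    refine (hnn _).lt_of_ne' fun h0 => hxy ?_
    rw [hp, Complex.ofReal_re] at h0
    rw [hp, h0, Complex.ofReal_zero]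
  set m := (f (pt x y)).re / 2
  have hm : 0 < m := half_pos hp
  have hev : ∀ᶠ p in 𝓝 (pt x y), m < (f p).re :=
    (Complex.continuous_re.comp hf).continuousAt.eventually_const_lt (half_lt_self hp)
  obtain ⟨δ, hδ, hball⟩ := Metric.eventually_nhds_iff_ball.1 hev
  set c₁ := (sphereArea n)⁻¹ * (m * (volume.real (Metric.ball (0 : XY n) (δ / 2)) / δ)) with hc₁
  have hV : 0 < volume.real (Metric.ball (0 : XY n) (δ / 2)) :=
    ENNReal.toReal_pos (Metric.measure_ball_pos _ _ (half_pos hδ)).ne' measure_ball_lt_top.ne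
  have hS := sphereArea_pos (n := n)
  have hc₁pos : 0 < c₁ := by positivity
  set B := |y| + δ
  have hB : 0 < B := by positivity
  have hlow : ∀ z : X n, c₁ * ((‖z - x‖ + B) ^ n)⁻¹ ≤ (bp (R f) x y z).re := by
    intro z
    set q : XY n := pt (x - z) y with hq
    have hqn : Real.sqrt (‖z - x‖ ^ 2 + y ^ 2) = ‖q‖ := by rw [hq, norm_pt, norm_sub_rev]
    have hqle : ‖q‖ ≤ ‖z - x‖ + |y| := by
      rw [← hqn]
      refine Real.sqrt_le_iff.2 ⟨by positivity, ?_⟩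
      nlinarith [mul_nonneg (norm_nonneg (z - x)) (abs_nonneg y), sq_abs y]
    set T : Set (Sph n) := {w | ‖q‖ • (w : XY n) ∈ Metric.ball q δ}
    have hTm : MeasurableSet T := measurableSet_ball.preimage (by fun_prop)
    have hi : Integrable (fun w : Sph n =>
        f (pt (z + ‖q‖ • (w : XY n).fst) (‖q‖ * (w : XY n).snd))) (surface n) :=
      integrable_sphere (hf.comp (by fun_prop))
    have hre : (bp (R f) x y z).re = (sphereArea n)⁻¹ * ∫ w : Sph n,
        (f (pt (z + ‖q‖ • (w : XY n).fst) (‖q‖ * (w : XY n).snd))).re ∂(surface n) := by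
      unfold bp R
      rw [hqn, Complex.re_ofReal_mul]
      congr 1
      exact (integral_re hi).symm
    have hT := le_toSphere_smul_mem_ball (volume : Measure (XY n)) (q := q) hδ
    rw [finrank_XY, Nat.add_sub_cancel] at hT
    have hint : m * (surface n).real T ≤ ∫ w : Sph n,
        (f (pt (z + ‖q‖ • (w : XY n).fst) (‖q‖ * (w : XY n).snd))).re ∂(surface n) := by
      rw [mul_comm, ← smul_eq_mul, ← integral_indicator_const _ hTm]
      refine integral_mono ((integrable_const m).indicator hTm) hi.re fun w => ?_
      by_cases hw : w ∈ T
      · rw [Set.indicator_of_mem hw, pt_add_smul]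
        refine (hball _ ?_).le
        have : pt x y = pt z 0 + q := by
          apply WithLp.ofLp_injective
          ext <;> simp [hq]
        rw [this, Metric.mem_ball, dist_add_left]
        exact hw
      · rw [Set.indicator_of_notMem hw]
        exact hnn _
    rw [hre]
    have hqB : ‖q‖ + δ ≤ ‖z - x‖ + B := by
      simp only [B]
      linarith
    calc c₁ * ((‖z - x‖ + B) ^ n)⁻¹ ≤ c₁ * ((‖q‖ + δ) ^ n)⁻¹ :=
          mul_le_mul_of_nonneg_left (inv_anti₀ (by positivity)
            (pow_le_pow_left₀ (by positivity) hqB n)) hc₁pos.le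
      _ = (sphereArea n)⁻¹ * (m * (volume.real (Metric.ball (0 : XY n) (δ / 2)) /
            (δ * (‖q‖ + δ) ^ n))) := by
          rw [hc₁]
          field_simp
      _ ≤ _ := by
          refine mul_le_mul_of_nonneg_left (le_trans ?_ hint) (inv_nonneg.2 hS.le)
          exact mul_le_mul_of_nonneg_left hT hm.le
  refine not_integrable_inv_norm_add_pow hn hB ?_
  have h1 : Integrable fun z : X n => c₁ * ((‖z - x‖ + B) ^ n)⁻¹ := by
    refine Integrable.mono' h.re ?_ (Eventually.of_forall fun z => ?_)
    · exact Measurable.aestronglyMeasurable (by fun_prop)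
    · rw [Real.norm_of_nonneg (by positivity)]
      exact hlow z
  have h2 := (integrable_const_mul_iff (isUnit_iff_ne_zero.2 hc₁pos.ne') _).1 h1
  simpa using h2.comp_add_right x

end Divergence

/-! ### Distributional Fourier transforms and uniqueness of the fractional Laplacian. -/

section Distributions

variable {n : ℕ}

theorem isFourierTransform_fourierInv {W : XY n → ℂ} (hW : Integrable W) :
    IsFourierTransform (𝓕⁻ W) W := by
  intro φ
  have hφ : Integrable fun p : XY n => (𝓕 φ) p := (𝓕 φ).integrable
  refine ⟨?_, ?_, ?_⟩
  · exact hφ.bdd_mul (continuous_fourierInv hW).aestronglyMeasurable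
      (Eventually.of_forall (norm_fourierInv_le W))
  · exact hW.mul_bdd φ.continuous.aestronglyMeasurable
      (Eventually.of_forall fun p => φ.toBoundedContinuousFunction.norm_coe_le_norm p)
  · simp_rw [fourierInv_eq_integral_e, ← integral_mul_const]
    rw [integral_integral_swap]
    · refine integral_congr_ae (Eventually.of_forall fun k => ?_)
      have h : 𝓕⁻ (𝓕 φ) = φ := FourierTransform.fourierInv_fourier_eq φ
      have h2 : φ k = ∫ p, e ⟪p, k⟫ * (𝓕 φ) p := by
        rw [← fourierInv_eq_integral_e, ← SchwartzMap.fourierInv_coe, h]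
      simp only
      rw [h2, ← integral_const_mul]
      refine integral_congr_ae (Eventually.of_forall fun p => ?_)
      simp only [real_inner_comm k p]
      ring
    · have h := integrable_e_mul (hφ.mul_prod hW) (u := fun q : XY n × XY n => ⟪q.2, q.1⟫)
        (Continuous.measurable (by fun_prop))
      refine h.congr (Eventually.of_forall fun q => ?_)
      simp only [Function.uncurry_def]
      ring

/-- Test against a bump function equal to `1` near the given point. -/
theorem locallyIntegrable_of_integrable_mul_schwartz {w : XY n → ℂ}
    (hw : ∀ φ : 𝓢(XY n, ℂ), Integrable fun k => w k * φ k) : LocallyIntegrable w := by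
  intro c
  let b : ContDiffBump c := ⟨1, 2, one_pos, one_lt_two⟩
  have hb : HasCompactSupport fun p => ((b p : ℝ) : ℂ) :=
    b.hasCompactSupport.comp_left Complex.ofReal_zero
  have hb' : ContDiff ℝ ∞ fun p => ((b p : ℝ) : ℂ) := Complex.ofRealCLM.contDiff.comp b.contDiff
  refine ⟨Metric.closedBall c 1, Metric.closedBall_mem_nhds c one_pos, ?_⟩
  refine ((hw (hb.toSchwartzMap hb')).integrableOn).congr_fun (fun p hp => ?_)
    Metric.isClosed_closedBall.measurableSet
  have : b p = 1 := b.one_of_mem_closedBall hp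
  simp [this]

theorem ae_eq_of_integral_mul_schwartz_eq {w w' : XY n → ℂ}
    (hw : ∀ φ : 𝓢(XY n, ℂ), Integrable fun k => w k * φ k)
    (hw' : ∀ φ : 𝓢(XY n, ℂ), Integrable fun k => w' k * φ k)
    (h : ∀ φ : 𝓢(XY n, ℂ), ∫ k, w k * φ k = ∫ k, w' k * φ k) : w =ᵐ[volume] w' := by
  refine ae_eq_of_integral_contDiff_smul_eq (locallyIntegrable_of_integrable_mul_schwartz hw)
    (locallyIntegrable_of_integrable_mul_schwartz hw') fun b hb hbs => ?_
  have hb₁ : HasCompactSupport fun p => ((b p : ℝ) : ℂ) := hbs.comp_left Complex.ofReal_zero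
  have hb₂ : ContDiff ℝ ∞ fun p => ((b p : ℝ) : ℂ) := Complex.ofRealCLM.contDiff.comp hb
  have := h (hb₁.toSchwartzMap hb₂)
  simpa [mul_comm] using this

/-- The distribution `u` determines its transform almost everywhere, hence also the multiplied
transform. Testing with `𝓕⁻ φ` recovers `v` almost everywhere, and continuity upgrades this to every
point. -/
theorem IsFracLaplacian.unique {s : ℝ} {u v v' : XY n → ℂ} (h : IsFracLaplacian s u v)
    (h' : IsFracLaplacian s u v') : v = v' := by
  obtain ⟨hv, w, hw, hvw⟩ := h
  obtain ⟨hv', w', hw', hvw'⟩ := h'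
  have hww : w =ᵐ[volume] w' := ae_eq_of_integral_mul_schwartz_eq (fun φ => (hw φ).2.1)
    (fun φ => (hw' φ).2.1) fun φ => (hw φ).2.2.symm.trans (hw' φ).2.2
  refine (hv.ae_eq_iff_eq volume hv').1 ?_
  have hinv : ∀ φ : 𝓢(XY n, ℂ), 𝓕 (𝓕⁻ φ) = φ := fun φ => FourierTransform.fourier_fourierInv_eq φ
  refine ae_eq_of_integral_mul_schwartz_eq (fun φ => ?_) (fun φ => ?_) fun φ => ?_
  · simpa [hinv] using (hvw (𝓕⁻ φ)).1
  · simpa [hinv] using (hvw' (𝓕⁻ φ)).1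
  · have h1 := (hvw (𝓕⁻ φ)).2.2
    have h2 := (hvw' (𝓕⁻ φ)).2.2
    rw [hinv] at h1 h2
    rw [h1, h2]
    refine integral_congr_ae (hww.mono fun k hk => ?_)
    simp only [hk]

end Distributions

/-! ### From the sine integral to the sign multiplier. -/

section Multiplier

variable {n : ℕ}

/-- The reflection `(x, y) ↦ (x, -y)`. -/
noncomputable def reflectSnd (n : ℕ) : XY n ≃ₗᵢ[ℝ] XY n :=
  LinearIsometryEquiv.withLpProdCongr 2 (LinearIsometryEquiv.refl ℝ (X n))
    (LinearIsometryEquiv.neg ℝ)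

@[simp] theorem reflectSnd_fst (p : XY n) : (reflectSnd n p).fst = p.fst := rfl

@[simp] theorem reflectSnd_snd (p : XY n) : (reflectSnd n p).snd = -p.snd := rfl

theorem measurable_real_sign : Measurable Real.sign := by
  have : Real.sign = fun r : ℝ => if r < 0 then (-1 : ℝ) else if 0 < r then 1 else 0 :=
    funext fun _ => rfl
  rw [this]
  exact Measurable.ite measurableSet_Iio measurable_const
    (Measurable.ite measurableSet_Ioi measurable_const measurable_const)

theorem norm_sign_le_one (r : ℝ) : ‖(Real.sign r : ℂ)‖ ≤ 1 := by
  rcases Real.sign_apply_eq r with h | h | h <;> simp [h]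

theorem integrable_sign_snd_mul {H : XY n → ℂ} (hH : Integrable H) :
    Integrable fun k : XY n => (Real.sign k.snd : ℂ) * H k := by
  refine hH.bdd_mul (c := 1) ?_ (Eventually.of_forall fun k => norm_sign_le_one _)
  exact (Complex.measurable_ofReal.comp (measurable_real_sign.comp
    continuous_XY_snd.measurable)).aestronglyMeasurable

/-- Average the right-hand integrand with its reflection in `k.snd`: `H` is even and the sign is
odd, so `e (k.snd * y)` is replaced by its odd part, a sine. -/
theorem integral_sine_eq_fourierInv_sign {H : XY n → ℂ} (hH : Integrable H)
    (heven : ∀ k, H (reflectSnd n k) = H k) (x : X n) (y : ℝ) :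
    Complex.I * ∫ k, e ⟪k.fst, x⟫ * H k * (Real.sin (2 * Real.pi * (y * |k.snd|)) : ℝ) =
      𝓕⁻ (fun k : XY n => (Real.sign k.snd : ℂ) * H k) (pt x y) := by
  rw [fourierInv_eq_integral_e]
  set I : XY n → ℂ := fun k => e ⟪k, pt x y⟫ * ((Real.sign k.snd : ℂ) * H k) with hI
  have hIi : Integrable I := integrable_e_mul (integrable_sign_snd_mul hH)
    (u := fun k => ⟪k, pt x y⟫) (Continuous.measurable (by fun_prop))
  have hA := (reflectSnd n).measurePreserving
  have hAe := (reflectSnd n).toHomeomorph.measurableEmbedding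
  have h1 : ∫ k, I (reflectSnd n k) = ∫ k, I k := hA.integral_comp hAe I
  have h2 : Integrable fun k => I (reflectSnd n k) := (hA.integrable_comp_emb hAe).2 hIi
  have h3 : ∫ k, I k = 2⁻¹ * ∫ k, (I k + I (reflectSnd n k)) := by
    rw [integral_add hIi h2, h1]
    ring
  rw [h3, ← integral_const_mul, ← integral_const_mul]
  refine integral_congr_ae (Eventually.of_forall fun k => ?_)
  simp only [hI, heven, inner_pt, reflectSnd_fst, reflectSnd_snd, Real.sign_neg, e_add]
  have hs : ((Real.sign k.snd : ℝ) : ℂ) * (e (k.snd * y) - e (-k.snd * y)) =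
      2 * Complex.I * (Real.sin (2 * Real.pi * (y * |k.snd|)) : ℝ) := by
    rw [neg_mul, e_sub_e_neg]
    rcases lt_trichotomy k.snd 0 with h | h | h
    · rw [Real.sign_of_neg h, abs_of_neg h, mul_neg, mul_neg, Real.sin_neg, mul_comm y]
      push_cast
      ring
    · simp [h]
    · rw [Real.sign_of_pos h, abs_of_pos h, mul_comm y]
      push_cast
      ring
  push_cast at hs ⊢
  linear_combination (-(e ⟪k.fst, x⟫ * H k / 2)) * hs

theorem fourier_reflectSnd {f : XY n → ℂ} (hf : ∀ x y, f (pt x (-y)) = f (pt x y)) (k : XY n) :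
    𝓕 f (reflectSnd n k) = 𝓕 f k := by
  have h : f ∘ reflectSnd n = f := funext fun p => hf p.fst p.snd
  rw [← Real.fourier_comp_linearIsometry, h]

end Multiplier

/-! ### The sine integral: bounds and limit. -/

section SineIntegral

/-- The sine integral `∫₀ˣ sin s / s ds`. -/
noncomputable def sineIntegral (x : ℝ) : ℝ := ∫ s in 0..x, Real.sinc s

theorem integral_exp_neg_mul_sin (a M : ℝ) :
    ∫ s in 0..M, Real.exp (-a * s) * Real.sin s =
      (1 + a ^ 2)⁻¹ - Real.exp (-a * M) * ((Real.cos M + a * Real.sin M) / (1 + a ^ 2)) := by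
  have hden : (1 + a ^ 2) ≠ 0 := by positivity
  have hderiv : ∀ s ∈ Set.uIcc 0 M, HasDerivAt
      (fun s => -(Real.exp (-a * s) * ((Real.cos s + a * Real.sin s) / (1 + a ^ 2))))
      (Real.exp (-a * s) * Real.sin s) s := by
    intro s _
    have h1 : HasDerivAt (fun s => Real.exp (-a * s)) (Real.exp (-a * s) * -a) s := by
      simpa using ((hasDerivAt_id s).const_mul (-a)).exp
    have h2 : HasDerivAt (fun s => (Real.cos s + a * Real.sin s) / (1 + a ^ 2))
        ((-Real.sin s + a * Real.cos s) / (1 + a ^ 2)) s :=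
      ((Real.hasDerivAt_cos s).add ((Real.hasDerivAt_sin s).const_mul a)).div_const _
    refine (h1.mul h2).neg.congr_deriv ?_
    field_simp
    ring
  rw [intervalIntegral.integral_eq_sub_of_hasDerivAt hderiv
    (Continuous.intervalIntegrable (by fun_prop) _ _)]
  simp
  ring

/-- Write `1 / s = ∫₀^∞ exp (-a s) da` and exchange the integrals. The explicit inner integral
contributes `∫₀^∞ (1 + a²)⁻¹ da = π / 2` and a remainder bounded by `∫₀^∞ 2 exp (-M a) da = 2 / M`.
-/
theorem abs_sineIntegral_sub_le {M : ℝ} (hM : 0 < M) :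
    |sineIntegral M - Real.pi / 2| ≤ 2 / M := by
  have hexp : ∀ s : ℝ, 0 < s → IntegrableOn (fun a : ℝ => Real.exp (-s * a)) (Set.Ioi 0) :=
    fun s hs => exp_neg_integrableOn_Ioi 0 hs
  have hexpint : ∀ s : ℝ, 0 < s → ∫ a in Set.Ioi (0 : ℝ), Real.exp (-s * a) = s⁻¹ := fun s hs => by
    rw [integral_exp_mul_Ioi (neg_lt_zero.2 hs)]
    simp
  have hexpint' : ∀ s : ℝ, 0 < s → ∫ a in Set.Ioi (0 : ℝ), Real.exp (-a * s) = s⁻¹ := fun s hs => by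
    rw [← hexpint s hs]
    congr 1
    ext a
    ring_nf
  have hsinc : sineIntegral M =
      ∫ s in Set.Ioc 0 M, ∫ a in Set.Ioi (0 : ℝ), Real.exp (-a * s) * Real.sin s := by
    rw [sineIntegral, intervalIntegral.integral_of_le hM.le]
    refine setIntegral_congr_fun measurableSet_Ioc fun s hs => ?_
    rw [integral_mul_const, Real.sinc_of_ne_zero hs.1.ne', div_eq_inv_mul, hexpint' s hs.1]
  have hprod : Integrable (Function.uncurry fun s a : ℝ => Real.exp (-a * s) * Real.sin s)
      ((volume.restrict (Set.Ioc 0 M)).prod (volume.restrict (Set.Ioi 0))) := by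
    rw [integrable_prod_iff (Continuous.aestronglyMeasurable
      (by simp only [Function.uncurry_def]; fun_prop))]
    constructor
    · filter_upwards [ae_restrict_mem measurableSet_Ioc] with s hs
      refine ((hexp s hs.1).mul_const (Real.sin s)).congr (Eventually.of_forall fun a => ?_)
      simp [mul_comm]
    · have hc : IntegrableOn (fun s : ℝ => ‖Real.sinc s‖) (Set.Ioc 0 M) :=
        ((Real.continuous_sinc.norm).intervalIntegrable 0 M).1
      refine hc.congr ?_
      filter_upwards [ae_restrict_mem measurableSet_Ioc] with s hs
      simp only [Function.uncurry_apply_pair, norm_mul, Real.norm_eq_abs, Real.abs_exp]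
      rw [integral_mul_const, Real.sinc_of_ne_zero hs.1.ne', abs_div, abs_of_pos hs.1,
        div_eq_inv_mul, hexpint' s hs.1]
  have hE : Integrable (fun a : ℝ => Real.exp (-a * M) *
      ((Real.cos M + a * Real.sin M) / (1 + a ^ 2))) (volume.restrict (Set.Ioi 0)) ∧
      ∀ a ∈ Set.Ioi (0 : ℝ), ‖Real.exp (-a * M) * ((Real.cos M + a * Real.sin M) / (1 + a ^ 2))‖ ≤
        2 * Real.exp (-M * a) := by
    have hb : ∀ a ∈ Set.Ioi (0 : ℝ),
        ‖Real.exp (-a * M) * ((Real.cos M + a * Real.sin M) / (1 + a ^ 2))‖ ≤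
        2 * Real.exp (-M * a) := by
      intro a ha
      have ha : 0 < a := ha
      rw [norm_mul, Real.norm_eq_abs, Real.abs_exp, mul_comm]
      have h1 : -a * M = -M * a := by ring
      rw [h1]
      refine mul_le_mul_of_nonneg_right ?_ (Real.exp_pos _).le
      rw [norm_div, Real.norm_eq_abs, Real.norm_of_nonneg (by positivity : 0 ≤ 1 + a ^ 2),
        div_le_iff₀ (by positivity)]
      calc |Real.cos M + a * Real.sin M| ≤ |Real.cos M| + |a * Real.sin M| := abs_add_le _ _
        _ ≤ 1 + a * 1 := by
            rw [abs_mul, abs_of_pos ha]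
            gcongr
            · exact Real.abs_cos_le_one M
            · exact Real.abs_sin_le_one M
        _ ≤ 2 * (1 + a ^ 2) := by nlinarith [sq_nonneg (a - 1)]
    refine ⟨Integrable.mono' ((hexp M hM).const_mul 2)
      (Measurable.aestronglyMeasurable (by fun_prop)) ?_, hb⟩
    filter_upwards [ae_restrict_mem measurableSet_Ioi] with a ha using hb a ha
  have hswap : sineIntegral M = Real.pi / 2 - ∫ a in Set.Ioi (0 : ℝ),
      Real.exp (-a * M) * ((Real.cos M + a * Real.sin M) / (1 + a ^ 2)) := by
    rw [hsinc, integral_integral_swap hprod]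
    have : ∀ a : ℝ, ∫ s in Set.Ioc 0 M, Real.exp (-a * s) * Real.sin s =
        (1 + a ^ 2)⁻¹ - Real.exp (-a * M) * ((Real.cos M + a * Real.sin M) / (1 + a ^ 2)) :=
      fun a => by
        rw [← intervalIntegral.integral_of_le hM.le, integral_exp_neg_mul_sin]
    simp only [this]
    rw [integral_sub integrable_inv_one_add_sq.integrableOn hE.1, integral_Ioi_inv_one_add_sq,
      Real.arctan_zero, sub_zero]
  rw [hswap, sub_right_comm, sub_self, zero_sub, abs_neg, ← Real.norm_eq_abs]
  refine (norm_integral_le_of_norm_le ((hexp M hM).const_mul 2) ?_).trans_eq ?_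
  · filter_upwards [ae_restrict_mem measurableSet_Ioi] with a ha using hE.2 a ha
  · rw [integral_const_mul, hexpint M hM, div_eq_mul_inv]

theorem tendsto_sineIntegral : Tendsto sineIntegral atTop (𝓝 (Real.pi / 2)) := by
  rw [tendsto_iff_norm_sub_tendsto_zero]
  refine squeeze_zero' (Eventually.of_forall fun _ => norm_nonneg _)
    ((eventually_gt_atTop 0).mono fun M hM => abs_sineIntegral_sub_le hM) ?_
  exact tendsto_const_nhds.div_atTop tendsto_id

theorem abs_sineIntegral_le {x : ℝ} (hx : 0 ≤ x) : |sineIntegral x| ≤ 4 := by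
  rcases le_or_gt x 1 with h | h
  · have := intervalIntegral.norm_integral_le_of_norm_le_const (a := 0) (b := x) (C := 1)
      (f := Real.sinc) fun s _ => Real.abs_sinc_le_one s
    rw [Real.norm_eq_abs, sub_zero, abs_of_nonneg hx] at this
    exact this.trans (by linarith)
  · have h1 := abs_sineIntegral_sub_le (zero_lt_one.trans h)
    have h2 : 2 / x ≤ 2 := div_le_self zero_le_two h.le
    have h3 := abs_le.1 (h1.trans h2)
    have := Real.pi_lt_d2
    have := Real.pi_pos
    rw [abs_le]
    constructor <;> linarith [h3.1, h3.2]

theorem continuous_sineIntegral : Continuous sineIntegral :=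
  intervalIntegral.continuous_primitive
    (fun a b => Real.continuous_sinc.intervalIntegrable a b) 0

theorem sineIntegral_zero : sineIntegral 0 = 0 := by simp [sineIntegral]

theorem integral_sin_mul_div {c a b : ℝ} (ha : 0 < a) (hab : a ≤ b) :
    ∫ s in a..b, Real.sin (c * s) / s = sineIntegral (c * b) - sineIntegral (c * a) := by
  unfold sineIntegral
  rw [intervalIntegral.integral_interval_sub_left
    (Real.continuous_sinc.intervalIntegrable _ _) (Real.continuous_sinc.intervalIntegrable _ _),
    ← intervalIntegral.mul_integral_comp_mul_left, ← intervalIntegral.integral_const_mul]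
  refine intervalIntegral.integral_congr fun s hs => ?_
  rw [Set.uIcc_of_le hab] at hs
  have hs0 : s ≠ 0 := (ha.trans_le hs.1).ne'
  rcases eq_or_ne c 0 with rfl | hc
  · simp
  · rw [Real.sinc_of_ne_zero (mul_ne_zero hc hs0)]
    field_simp

end SineIntegral

/-! ### Hilbert transform of a function with a sign in its spectrum. -/

section HilbertTransform

/-- The inverse Fourier transform of `i sgn(η) ψ(η)`. -/
noncomputable def signTransform (ψ : ℝ → ℂ) (y : ℝ) : ℂ :=
  ∫ η, e (η * y) * (Complex.I * Real.sign η * ψ η)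

theorem integrable_sign_mul {ψ : ℝ → ℂ} (hψ : Integrable ψ) :
    Integrable fun η : ℝ => Complex.I * Real.sign η * ψ η := by
  refine hψ.bdd_mul (c := 1) ?_ (Eventually.of_forall fun η => ?_)
  · have := Complex.measurable_ofReal.comp measurable_real_sign
    exact (this.const_mul Complex.I).aestronglyMeasurable
  · rw [norm_mul, Complex.norm_I, one_mul]
    exact norm_sign_le_one η

theorem continuous_signTransform {ψ : ℝ → ℂ} (hψ : Integrable ψ) :
    Continuous (signTransform ψ) := by
  have h := integrable_sign_mul hψ
  refine continuous_of_dominated (bound := fun η => ‖Complex.I * Real.sign η * ψ η‖) (fun y => ?_)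
    (fun y => ?_) h.norm ?_
  · exact (integrable_e_mul h (u := fun η => η * y) (by fun_prop)).aestronglyMeasurable
  · exact Eventually.of_forall fun η => by simp
  · exact Eventually.of_forall fun η => by fun_prop

theorem norm_sign_mul_le (η : ℝ) (z : ℂ) : ‖Complex.I * Real.sign η * z‖ ≤ ‖z‖ := by
  rw [norm_mul, norm_mul, Complex.norm_I, one_mul]
  exact mul_le_of_le_one_left (norm_nonneg _) (norm_sign_le_one η)

theorem norm_signTransform_le {ψ : ℝ → ℂ} (hψ : Integrable ψ) (y : ℝ) :
    ‖signTransform ψ y‖ ≤ ∫ η, ‖ψ η‖ := by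
  refine norm_integral_le_of_norm_le hψ.norm (Eventually.of_forall fun η => ?_)
  rw [norm_mul, norm_e, one_mul]
  exact norm_sign_mul_le η _

theorem integral_sign_mul {F : ℝ → ℂ} (hF : Integrable F) :
    ∫ η, (Real.sign η : ℂ) * F η = (∫ η in Set.Ioi (0 : ℝ), F η) - ∫ η in Set.Iic (0 : ℝ), F η := by
  have hi : Integrable fun η : ℝ => (Real.sign η : ℂ) * F η :=
    hF.bdd_mul (c := 1) (Complex.measurable_ofReal.comp measurable_real_sign).aestronglyMeasurable
      (Eventually.of_forall norm_sign_le_one)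
  rw [← intervalIntegral.integral_Iic_add_Ioi (b := 0) hi.integrableOn hi.integrableOn, add_comm,
    sub_eq_add_neg, ← integral_neg]
  congr 1
  · refine setIntegral_congr_fun measurableSet_Ioi fun η hη => ?_
    simp [Real.sign_of_pos hη]
  · rw [integral_Iic_eq_integral_Iio, integral_Iic_eq_integral_Iio]
    refine setIntegral_congr_fun measurableSet_Iio fun η hη => ?_
    simp [Real.sign_of_neg hη]

/-- Integrate by parts on each half-line. The jump of the sign at `0` leaves the boundary term `2 ψ
0`, so `1 / |y|` decay is what is proved: enough for `L²` and for the truncated integrals to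
converge absolutely. -/
theorem abs_mul_norm_signTransform_le (ψ : 𝓢(ℝ, ℂ)) (y : ℝ) :
    |y| * ‖signTransform ψ y‖ ≤ 2 * ‖ψ 0‖ + ∫ η, ‖deriv ψ η‖ := by
  have hψ' : Integrable (deriv ψ) := by
    have := (SchwartzMap.derivCLM ℝ ℂ ψ).integrable (μ := volume)
    refine this.congr (Eventually.of_forall fun η => ?_)
    simp
  set Ψ : ℝ → ℂ := fun η => e (η * y) * ψ η with hΨ
  set Ψ₁ : ℝ → ℂ := fun η => e (η * y) * deriv ψ η with hΨ₁
  have hΨi : Integrable Ψ :=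
    integrable_e_mul ψ.integrable (u := fun η => η * y) (by fun_prop)
  have hΨ₁i : Integrable Ψ₁ := integrable_e_mul hψ' (u := fun η => η * y) (by fun_prop)
  have hder : ∀ η, HasDerivAt Ψ (2 * Real.pi * Complex.I * y * Ψ η + Ψ₁ η) η := by
    intro η
    have h0 : HasDerivAt (fun η : ℝ => η * y) y η := by
      simpa using (hasDerivAt_id η).mul_const y
    have h1 : HasDerivAt (fun η => e (η * y)) (y • (2 * Real.pi * Complex.I * e (η * y))) η :=
      HasDerivAt.scomp (g₁ := e) (h := fun η : ℝ => η * y) η (hasDerivAt_e (η * y)) h0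
    have h2 : HasDerivAt ψ (deriv ψ η) η := ψ.differentiableAt.hasDerivAt
    refine (h1.mul h2).congr_deriv ?_
    simp only [hΨ, hΨ₁, Complex.real_smul]
    ring
  have hderi : Integrable fun η => 2 * Real.pi * Complex.I * y * Ψ η + Ψ₁ η :=
    (hΨi.const_mul _).add hΨ₁i
  have hnorm : ∀ η, ‖Ψ η‖ = ‖ψ η‖ := fun η => by simp [hΨ]
  have hlim : ∀ l : Filter ℝ, l ≤ cocompact ℝ → Tendsto Ψ l (𝓝 0) := fun l hl => by
    rw [tendsto_zero_iff_norm_tendsto_zero]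
    simp only [hnorm]
    exact tendsto_zero_iff_norm_tendsto_zero.1 (ψ.tendsto_cocompact.mono_left hl)
  have hIoi := integral_Ioi_of_hasDerivAt_of_tendsto' (a := 0) (fun η _ => hder η)
    hderi.integrableOn (hlim atTop atTop_le_cocompact)
  have hIic := integral_Iic_of_hasDerivAt_of_tendsto' (a := 0) (fun η _ => hder η)
    hderi.integrableOn (hlim atBot atBot_le_cocompact)
  have hsum := integral_sign_mul hderi
  rw [hIoi, hIic] at hsum
  have hΨ0 : Ψ 0 = ψ 0 := by simp [hΨ]
  have hsΨ : ∀ {F : ℝ → ℂ}, Integrable F → Integrable fun η : ℝ => (Real.sign η : ℂ) * F η :=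
    fun hF => hF.bdd_mul (c := 1)
      (Complex.measurable_ofReal.comp measurable_real_sign).aestronglyMeasurable
      (Eventually.of_forall norm_sign_le_one)
  have hsplit : ∫ η, (Real.sign η : ℂ) * (2 * Real.pi * Complex.I * y * Ψ η + Ψ₁ η) =
      2 * Real.pi * y * signTransform ψ y + ∫ η, (Real.sign η : ℂ) * Ψ₁ η := by
    unfold signTransform
    rw [← integral_const_mul, ← integral_add _ (hsΨ hΨ₁i)]
    · refine integral_congr_ae (Eventually.of_forall fun η => ?_)
      simp only [hΨ]
      ring
    · exact (integrable_e_mul (integrable_sign_mul ψ.integrable) (u := fun η => η * y)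
        (by fun_prop)).const_mul _
  rw [hsplit, hΨ0] at hsum
  have hnormint : ‖∫ η, (Real.sign η : ℂ) * Ψ₁ η‖ ≤ ∫ η, ‖deriv ψ η‖ := by
    refine norm_integral_le_of_norm_le hψ'.norm (Eventually.of_forall fun η => ?_)
    rw [norm_mul, norm_mul, norm_e, one_mul]
    exact mul_le_of_le_one_left (norm_nonneg _) (norm_sign_le_one η)
  have heq : 2 * Real.pi * y * signTransform ψ y =
      -(2 * ψ 0) - ∫ η, (Real.sign η : ℂ) * Ψ₁ η := by linear_combination hsum
  have hle : ‖2 * Real.pi * y * signTransform ψ y‖ ≤ 2 * ‖ψ 0‖ + ∫ η, ‖deriv ψ η‖ := by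
    rw [heq]
    refine (norm_sub_le _ _).trans (add_le_add ?_ hnormint)
    simp
  refine le_trans ?_ hle
  rw [norm_mul, norm_mul, norm_mul, Complex.norm_real, Complex.norm_real, Real.norm_eq_abs,
    Real.norm_eq_abs, abs_of_pos Real.pi_pos, RCLike.norm_ofNat]
  refine mul_le_mul_of_nonneg_right ?_ (norm_nonneg _)
  refine le_mul_of_one_le_left (abs_nonneg _) ?_
  linarith [Real.two_le_pi]

theorem exists_norm_signTransform_le (ψ : 𝓢(ℝ, ℂ)) :
    ∃ C, 0 ≤ C ∧ ∀ y, ‖signTransform ψ y‖ ≤ C / (1 + |y|) := by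
  refine ⟨(∫ η, ‖ψ η‖) + (2 * ‖ψ 0‖ + ∫ η, ‖deriv ψ η‖), ?_, fun y => ?_⟩
  · have h1 : 0 ≤ ∫ η, ‖ψ η‖ := integral_nonneg fun _ => norm_nonneg _
    have h2 : 0 ≤ ∫ η, ‖deriv ψ η‖ := integral_nonneg fun _ => norm_nonneg _
    positivity
  · rw [le_div_iff₀ (by positivity), mul_add, mul_one, mul_comm _ |y|]
    exact add_le_add (norm_signTransform_le ψ.integrable y) (abs_mul_norm_signTransform_le ψ y)

theorem integrable_inv_one_add_abs_sq : Integrable fun t : ℝ => ((1 + |t|) ^ 2)⁻¹ := by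
  have h : Integrable fun r : ℝ => (1 + ‖r‖) ^ (-2 : ℝ) := integrable_one_add_norm (by simp)
  refine h.congr (Eventually.of_forall fun r => ?_)
  simp only [Real.norm_eq_abs]
  rw [Real.rpow_neg (by positivity)]
  congr 1
  exact_mod_cast Real.rpow_natCast (1 + |r|) 2

theorem memLp_signTransform (ψ : 𝓢(ℝ, ℂ)) : MemLp (signTransform ψ) 2 := by
  obtain ⟨C, hC0, hC⟩ := exists_norm_signTransform_le ψ
  have hcont := continuous_signTransform (ψ.integrable (μ := volume))
  rw [memLp_two_iff_integrable_sq_norm hcont.aestronglyMeasurable]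
  refine Integrable.mono' (integrable_inv_one_add_abs_sq.const_mul (C ^ 2))
    (hcont.norm.pow 2).aestronglyMeasurable (Eventually.of_forall fun y => ?_)
  rw [Real.norm_of_nonneg (by positivity), ← div_eq_mul_inv, ← div_pow]
  exact pow_le_pow_left₀ (norm_nonneg _) (hC y) 2

theorem measurableSet_lt_abs_sub (y ε : ℝ) : MeasurableSet {t : ℝ | ε < |y - t|} :=
  measurableSet_lt measurable_const (by fun_prop)

theorem integrableOn_truncated_hilbert (ψ : 𝓢(ℝ, ℂ)) (y : ℝ) {ε : ℝ} (hε : 0 < ε) :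
    IntegrableOn (fun t : ℝ => signTransform ψ t / ((y - t : ℝ) : ℂ)) {t | ε < |y - t|} := by
  obtain ⟨C, hC0, hC⟩ := exists_norm_signTransform_le ψ
  have hcont := continuous_signTransform (ψ.integrable (μ := volume))
  refine Integrable.mono'
    ((integrable_inv_one_add_abs_sq.const_mul (C * ((1 + |y|) / ε + 1))).integrableOn) ?_ ?_
  · have := hcont.measurable
    exact Measurable.aestronglyMeasurable (by fun_prop)
  · filter_upwards [ae_restrict_mem (measurableSet_lt_abs_sub y ε)] with t ht
    have ht : ε < |y - t| := ht
    have hpos : 0 < |y - t| := hε.trans ht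
    rw [norm_div, Complex.norm_real, Real.norm_eq_abs]
    have h1 : 1 + |t| ≤ |y - t| * ((1 + |y|) / ε + 1) := by
      have h2 : |t| ≤ |y| + |y - t| := by
        have := abs_sub_abs_le_abs_sub t y
        rw [abs_sub_comm] at this
        linarith
      have h3 : 1 + |y| ≤ |y - t| * ((1 + |y|) / ε) := by
        rw [mul_div_assoc', le_div_iff₀ hε, mul_comm]
        gcongr
      rw [mul_add, mul_one]
      linarith
    rw [div_le_iff₀ hpos]
    refine (hC t).trans ?_
    rw [div_le_iff₀ (by positivity), ← div_eq_mul_inv]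
    have h4 : C * (1 + |t|) ≤ C * ((1 + |y|) / ε + 1) * |y - t| :=
      (mul_le_mul_of_nonneg_left h1 hC0).trans_eq (by ring)
    calc C = C * (1 + |t|) / (1 + |t|) := by field_simp
      _ ≤ C * ((1 + |y|) / ε + 1) * |y - t| / (1 + |t|) := by gcongr
      _ = _ := by field_simp

theorem signTransform_sub_sub_add {ψ : ℝ → ℂ} (hψ : Integrable ψ) (y s : ℝ) :
    signTransform ψ (y - s) - signTransform ψ (y + s) =
      2 * ∫ η, e (η * y) * ψ η * (Real.sin (2 * Real.pi * |η| * s) : ℝ) := by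
  have h : ∀ t : ℝ, Integrable fun η : ℝ => e (η * t) * (Complex.I * Real.sign η * ψ η) :=
    fun t => integrable_e_mul (integrable_sign_mul hψ) (u := fun η => η * t) (by fun_prop)
  unfold signTransform
  rw [← integral_sub (h _) (h _), ← integral_const_mul]
  refine integral_congr_ae (Eventually.of_forall fun η => ?_)
  simp only
  have h1 : e (η * (y - s)) = e (η * y) * e (-(η * s)) := by rw [← e_add]; ring_nf
  have h2 : e (η * (y + s)) = e (η * y) * e (η * s) := by rw [← e_add]; ring_nf
  have h3 : (Real.sign η : ℂ) * (e (η * s) - e (-(η * s))) =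
      2 * Complex.I * (Real.sin (2 * Real.pi * |η| * s) : ℝ) := by
    rw [e_sub_e_neg]
    rcases lt_trichotomy η 0 with h | h | h
    · rw [Real.sign_of_neg h, abs_of_neg h, mul_neg, neg_mul, Real.sin_neg, mul_assoc]
      push_cast
      ring_nf
    · simp [h]
    · rw [Real.sign_of_pos h, abs_of_pos h, mul_assoc]
      push_cast
      ring_nf
  rw [h1, h2]
  push_cast at h3 ⊢
  linear_combination (-Complex.I * e (η * y) * ψ η) * h3 - 2 * e (η * y) * ψ η *
    Complex.sin (2 * Real.pi * |η| * s) * Complex.I_sq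

/-- Substitute `t = y - s` and fold `s < -ε` onto `s > ε`; the symmetric difference then produces a
sine in the frequency integral. -/
theorem truncated_hilbert_eq (ψ : 𝓢(ℝ, ℂ)) (y : ℝ) {ε : ℝ} (hε : 0 < ε) :
    IntegrableOn (fun s : ℝ => (signTransform ψ (y - s) - signTransform ψ (y + s)) / (s : ℂ))
      (Set.Ioi ε) ∧
    ∫ t in {t : ℝ | ε < |y - t|}, signTransform ψ t / ((y - t : ℝ) : ℂ) =
      ∫ s in Set.Ioi ε, (signTransform ψ (y - s) - signTransform ψ (y + s)) / (s : ℂ) := by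
  set G : ℝ → ℂ := fun s => signTransform ψ (y - s) / (s : ℂ) with hG
  have hInd : ∀ s, ({t : ℝ | ε < |y - t|}.indicator
      (fun t : ℝ => signTransform ψ t / ((y - t : ℝ) : ℂ))) (y - s) =
      {s : ℝ | ε < |s|}.indicator G s := by
    intro s
    by_cases hs : ε < |s|
    · rw [Set.indicator_of_mem (show s ∈ {s : ℝ | ε < |s|} from hs), Set.indicator_of_mem]
      · simp [hG]
      · simpa using hs
    · rw [Set.indicator_of_notMem (show s ∉ {s : ℝ | ε < |s|} from hs), Set.indicator_of_notMem]
      simpa using hs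
  have hm : MeasurableSet {s : ℝ | ε < |s|} := measurableSet_lt measurable_const (by fun_prop)
  have hi := (integrable_indicator_iff (measurableSet_lt_abs_sub y ε)).2
    (integrableOn_truncated_hilbert ψ y hε)
  have hGi : IntegrableOn G {s : ℝ | ε < |s|} := by
    rw [← integrable_indicator_iff hm]
    exact (hi.comp_sub_left y).congr (Eventually.of_forall hInd)
  have hset : {s : ℝ | ε < |s|} = Set.Iio (-ε) ∪ Set.Ioi ε := by
    ext s
    simp only [Set.mem_ofPred_eq, Set.mem_union, Set.mem_Iio, Set.mem_Ioi, lt_abs]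
    constructor
    · rintro (h | h)
      · exact Or.inr h
      · exact Or.inl (by linarith)
    · rintro (h | h)
      · exact Or.inr (by linarith)
      · exact Or.inl h
  have hG1 : IntegrableOn G (Set.Iio (-ε)) := hGi.mono_set (hset ▸ Set.subset_union_left)
  have hG2 : IntegrableOn G (Set.Ioi ε) := hGi.mono_set (hset ▸ Set.subset_union_right)
  have hG1' : IntegrableOn (fun s => G (-s)) (Set.Ioi ε) := by
    rw [← integrable_indicator_iff measurableSet_Ioi]
    have := ((integrable_indicator_iff measurableSet_Iio).2 hG1).comp_neg
    refine this.congr (Eventually.of_forall fun s => ?_)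
    simp [Set.indicator, neg_lt_neg_iff]
  have hsum : ∀ s, G (-s) + G s =
      (signTransform ψ (y - s) - signTransform ψ (y + s)) / (s : ℂ) := by
    intro s
    simp only [hG, sub_neg_eq_add, Complex.ofReal_neg, div_neg]
    ring
  refine ⟨(hG1'.add hG2).congr (Eventually.of_forall fun s => hsum s), ?_⟩
  rw [← integral_indicator (measurableSet_lt_abs_sub y ε), ← integral_sub_left_eq_self _ volume y]
  simp only [hInd]
  rw [integral_indicator hm, hset, setIntegral_union _ measurableSet_Ioi hG1 hG2,
    ← integral_Iic_eq_integral_Iio]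
  · have h := integral_comp_neg_Ioi ε G
    rw [← h, ← integral_add hG1' hG2]
    simp only [hsum]
  · rw [Set.disjoint_left]
    intro s h1 h2
    have h1 : s < -ε := h1
    have h2 : ε < s := h2
    linarith

theorem integral_symmetric_difference (ψ : 𝓢(ℝ, ℂ)) (y : ℝ) {ε M : ℝ} (hε : 0 < ε) (hM : ε ≤ M) :
    ∫ s in ε..M, (signTransform ψ (y - s) - signTransform ψ (y + s)) / (s : ℂ) =
      2 * ∫ η, e (η * y) * ψ η *
        ((sineIntegral (2 * Real.pi * |η| * M) - sineIntegral (2 * Real.pi * |η| * ε) : ℝ) : ℂ) := by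
  have hE : Integrable fun η : ℝ => e (η * y) * ψ η :=
    integrable_e_mul ψ.integrable (u := fun η => η * y) (by fun_prop)
  have h1 : ∀ s : ℝ, (signTransform ψ (y - s) - signTransform ψ (y + s)) / (s : ℂ) =
      2 * ∫ η, e (η * y) * ψ η * ((Real.sin (2 * Real.pi * |η| * s) / s : ℝ) : ℂ) := by
    intro s
    rw [signTransform_sub_sub_add ψ.integrable, mul_div_assoc, ← integral_div]
    congr 2
    ext η
    push_cast
    ring
  simp only [h1]
  rw [intervalIntegral.integral_const_mul, intervalIntegral.integral_of_le hM,
    integral_integral_swap]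
  · congr 2
    ext η
    rw [integral_const_mul, integral_complex_ofReal, ← intervalIntegral.integral_of_le hM,
      integral_sin_mul_div hε hM]
  · refine Integrable.mono' (g := fun q : ℝ × ℝ => ε⁻¹ * ‖ψ q.2‖) ?_ ?_ ?_
    · exact (integrable_const (μ := volume.restrict (Set.Ioc ε M)) ε⁻¹).mul_prod
        (ψ.integrable (μ := volume)).norm
    · have := ψ.continuous.measurable
      exact Measurable.aestronglyMeasurable (by simp only [Function.uncurry_def]; fun_prop)
    · have : ∀ᵐ q : ℝ × ℝ ∂((volume.restrict (Set.Ioc ε M)).prod volume), q.1 ∈ Set.Ioc ε M :=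
        Measure.quasiMeasurePreserving_fst.ae (ae_restrict_mem measurableSet_Ioc)
      filter_upwards [this] with q hq
      simp only [Function.uncurry_def]
      have hq0 : 0 < q.1 := hε.trans hq.1
      rw [norm_mul, norm_mul, norm_e, one_mul, Complex.norm_real, norm_div, Real.norm_eq_abs,
        Real.norm_of_nonneg hq0.le, mul_comm]
      refine mul_le_mul_of_nonneg_right ?_ (norm_nonneg _)
      rw [inv_eq_one_div]
      exact div_le_div₀ zero_le_one (Real.abs_sin_le_one _) hε hq.1.le

/-- Dominated convergence, used for both limits `M → ∞` and `ε → 0+`. The constant `8` covers a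
difference of two sine integrals, each at most `4`. The frequency `0` is excluded because the sine
integral stays `0` there as `M → ∞`. -/
theorem tendsto_integral_e_mul_of_tendsto (ψ : 𝓢(ℝ, ℂ)) (y : ℝ) {l : Filter ℝ}
    [l.IsCountablyGenerated] (F : ℝ → ℝ → ℝ) (L : ℝ → ℝ) (hm : ∀ M, Measurable (F M))
    (hb : ∀ᶠ M in l, ∀ η, |F M η| ≤ 8) (hF : ∀ η, η ≠ 0 → Tendsto (fun M => F M η) l (𝓝 (L η))) :
    Tendsto (fun M => ∫ η, e (η * y) * ψ η * (F M η : ℂ)) l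
      (𝓝 (∫ η, e (η * y) * ψ η * (L η : ℂ))) := by
  have hE : Integrable fun η : ℝ => e (η * y) * ψ η :=
    integrable_e_mul ψ.integrable (u := fun η => η * y) (by fun_prop)
  refine tendsto_integral_filter_of_dominated_convergence (fun η => ‖ψ η‖ * 8) ?_ ?_
    (ψ.integrable.norm.mul_const _) ?_
  · exact Eventually.of_forall fun M => hE.aestronglyMeasurable.mul
      (Complex.measurable_ofReal.comp (hm M)).aestronglyMeasurable
  · filter_upwards [hb] with M hM
    refine Eventually.of_forall fun η => ?_
    rw [norm_mul, norm_mul, norm_e, one_mul, Complex.norm_real]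
    gcongr
    exact hM η
  · have : ∀ᵐ η : ℝ, η ≠ 0 := Measure.ae_ne volume 0
    filter_upwards [this] with η hη
    exact ((Complex.continuous_ofReal.tendsto (L η)).comp (hF η hη)).const_mul _

/-- After exchanging integrals, each frequency carries `π / 2` minus a sine integral that vanishes
as `ε → 0+`. The limit has the factor `π⁻¹ * 2 * (π / 2) = 1`. -/
theorem isHilbertTransform_signTransform (ψ : 𝓢(ℝ, ℂ)) :
    IsHilbertTransform (signTransform ψ) fun y => ∫ η, e (η * y) * ψ η := by
  refine ⟨memLp_signTransform ψ, fun y => ⟨fun ε hε => integrableOn_truncated_hilbert ψ y hε, ?_⟩⟩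
  have hSm := continuous_sineIntegral.measurable
  have htrunc : ∀ ε : ℝ, 0 < ε →
      ∫ t in {t : ℝ | ε < |y - t|}, signTransform ψ t / ((y - t : ℝ) : ℂ) =
      2 * ∫ η, e (η * y) * ψ η *
        ((Real.pi / 2 - sineIntegral (2 * Real.pi * |η| * ε) : ℝ) : ℂ) := by
    intro ε hε
    obtain ⟨hi, heq⟩ := truncated_hilbert_eq ψ y hε
    rw [heq]
    -- The kernel `sin (c s) / s` is not absolutely integrable on `(ε, ∞)`, so Fubini is applied on
    -- `(ε, M]` and then `M → ∞`.
    refine tendsto_nhds_unique (intervalIntegral_tendsto_integral_Ioi ε hi tendsto_id) ?_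
    have hev : ∀ᶠ M in atTop, 2 * (∫ η, e (η * y) * ψ η *
        ((sineIntegral (2 * Real.pi * |η| * M) - sineIntegral (2 * Real.pi * |η| * ε) : ℝ) : ℂ)) =
        ∫ s in ε..M, (signTransform ψ (y - s) - signTransform ψ (y + s)) / (s : ℂ) :=
      (eventually_ge_atTop ε).mono fun M hM => (integral_symmetric_difference ψ y hε hM).symm
    refine Tendsto.congr' hev (Tendsto.const_mul 2 ?_)
    refine tendsto_integral_e_mul_of_tendsto ψ y
      (fun M η => sineIntegral (2 * Real.pi * |η| * M) - sineIntegral (2 * Real.pi * |η| * ε))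
      (fun η => Real.pi / 2 - sineIntegral (2 * Real.pi * |η| * ε)) (fun M => by fun_prop) ?_ ?_
    · filter_upwards [eventually_ge_atTop 0] with M hM η
      refine (abs_sub _ _).trans ?_
      have h1 := abs_sineIntegral_le (x := 2 * Real.pi * |η| * M) (by positivity)
      have h2 := abs_sineIntegral_le (x := 2 * Real.pi * |η| * ε) (by positivity)
      linarith
    · intro η hη
      refine Tendsto.sub_const (tendsto_sineIntegral.comp ?_) _
      exact tendsto_id.const_mul_atTop (by positivity)
  have hlim := tendsto_integral_e_mul_of_tendsto ψ y (l := 𝓝[>] (0 : ℝ))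
    (fun ε η => Real.pi / 2 - sineIntegral (2 * Real.pi * |η| * ε)) (fun _ => Real.pi / 2)
    (fun ε => by fun_prop) ?_ ?_
  · rw [integral_mul_const] at hlim
    have h2 := (hlim.const_mul 2).const_mul ((Real.pi⁻¹ : ℝ) : ℂ)
    have h3 : ((Real.pi⁻¹ : ℝ) : ℂ) * (2 * ((∫ η, e (η * y) * ψ η) * ((Real.pi / 2 : ℝ) : ℂ))) =
        ∫ η, e (η * y) * ψ η := by
      have : (Real.pi : ℂ) ≠ 0 := by exact_mod_cast Real.pi_ne_zero
      generalize (∫ η, e (η * y) * ψ η) = J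
      push_cast
      field_simp
    rw [h3] at h2
    refine h2.congr' ?_
    filter_upwards [self_mem_nhdsWithin] with ε hε
    rw [htrunc ε hε]
  · filter_upwards [self_mem_nhdsWithin] with ε hε η
    have hε : 0 < ε := hε
    have h1 := abs_le.1 (abs_sineIntegral_le (x := 2 * Real.pi * |η| * ε) (by positivity))
    have := Real.pi_le_four
    have := Real.pi_pos
    rw [abs_le]
    constructor <;> linarith [h1.1, h1.2]
  · intro η _
    have h1 : Tendsto (fun ε : ℝ => Real.pi / 2 - sineIntegral (2 * Real.pi * |η| * ε)) (𝓝 0)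
        (𝓝 (Real.pi / 2 - sineIntegral (2 * Real.pi * |η| * 0))) := by
      have := continuous_sineIntegral
      exact Continuous.tendsto (by fun_prop) 0
    rw [mul_zero, sineIntegral_zero, sub_zero] at h1
    exact h1.mono_left nhdsWithin_le_nhds

end HilbertTransform

/-! ### Restriction to vertical lines. -/

section Slices

variable {n : ℕ}

theorem contDiff_slice {f : XY n → ℂ} (hf : ContDiff ℝ ∞ f) (x : X n) :
    ContDiff ℝ ∞ fun t : ℝ => f (pt x t) :=
  hf.comp ((WithLp.prodContinuousLinearEquiv 2 ℝ (X n) ℝ).symm.contDiff.comp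
    (contDiff_const.prodMk contDiff_id))

theorem exists_norm_bound_of_hasCompactSupport {f : XY n → ℂ} (hf : HasCompactSupport f) :
    ∃ A, ∀ p, A ≤ ‖p‖ → f p = 0 := by
  obtain ⟨A, hA⟩ := hf.isCompact.isBounded.subset_ball 0
  refine ⟨A, fun p hp => image_eq_zero_of_notMem_tsupport fun h => ?_⟩
  exact absurd (mem_ball_zero_iff.1 (hA h)) (not_lt.2 hp)

theorem hasCompactSupport_slice {f : XY n → ℂ} (hf : HasCompactSupport f) (x : X n) :
    HasCompactSupport fun t : ℝ => f (pt x t) := by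
  obtain ⟨A, hA⟩ := exists_norm_bound_of_hasCompactSupport hf
  refine HasCompactSupport.intro (isCompact_closedBall (0 : ℝ) A) fun t ht => hA _ ?_
  rw [mem_closedBall_zero_iff, Real.norm_eq_abs, not_le] at ht
  exact ht.le.trans (abs_snd_le_norm (pt x t))

/-- The partial inverse Fourier transform in the first variable. -/
noncomputable def partialFourierInv (g : XY n → ℂ) (x : X n) (η : ℝ) : ℂ :=
  ∫ ξ : X n, e ⟪ξ, x⟫ * g (pt ξ η)

theorem fourierInv_mul_snd {m : ℝ → ℂ} {g : XY n → ℂ}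
    (hmg : Integrable fun k : XY n => m k.snd * g k) (x : X n) (y : ℝ) :
    𝓕⁻ (fun k : XY n => m k.snd * g k) (pt x y) =
      ∫ η, e (η * y) * (m η * partialFourierInv g x η) := by
  rw [fourierInv_eq_integral_e, integral_XY_eq' (integrable_e_mul hmg
    (u := fun k => ⟪k, pt x y⟫) (Continuous.measurable (by fun_prop)))]
  refine integral_congr_ae (Eventually.of_forall fun η => ?_)
  simp only [partialFourierInv]
  rw [← integral_const_mul, ← integral_const_mul]
  refine integral_congr_ae (Eventually.of_forall fun ξ => ?_)
  simp only [inner_pt, e_add]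
  change e ⟪ξ, x⟫ * e (η * y) * (m η * g (pt ξ η)) =
    e (η * y) * (m η * (e ⟪ξ, x⟫ * g (pt ξ η)))
  ring

theorem integrable_partialFourierInv {g : XY n → ℂ} (hg : Integrable g) (x : X n) :
    Integrable (partialFourierInv g x) :=
  (integrable_comp_pt_iff.2 (integrable_e_mul hg (u := fun k => ⟪k.fst, x⟫)
    (Continuous.measurable (by fun_prop)))).integral_prod_right

theorem continuous_partialFourierInv (g : 𝓢(XY n, ℂ)) (x : X n) :
    Continuous (partialFourierInv g x) := by
  obtain ⟨C, hC⟩ := exists_one_add_norm_pow_mul_le g (n + 1)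
  have h1 : Integrable fun ξ : X n => (1 + ‖ξ‖) ^ (-((n + 1 : ℕ) : ℝ)) :=
    integrable_one_add_norm (by simp)
  have hg := g.continuous
  refine continuous_of_dominated (fun η => Continuous.aestronglyMeasurable (by fun_prop))
    (fun η => Eventually.of_forall fun ξ => ?_) (h1.const_mul C)
    (Eventually.of_forall fun ξ => by fun_prop)
  rw [norm_mul, norm_e, one_mul, Real.rpow_neg (by positivity), Real.rpow_natCast,
    ← div_eq_mul_inv, le_div_iff₀ (by positivity), mul_comm]
  refine le_trans ?_ (hC (pt ξ η))
  gcongr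
  exact norm_fst_le_norm (pt ξ η)

/-- Both sides have inverse transform `f (pt x ·)`. The identity makes the partial transform of `g`
a Schwartz function of `η`, as the one-variable Hilbert transform result requires. -/
theorem partialFourierInv_eq_fourier {g : 𝓢(XY n, ℂ)} {f : XY n → ℂ}
    (hfg : f = 𝓕⁻ (g : XY n → ℂ)) (x : X n) (φ : 𝓢(ℝ, ℂ)) (hφ : ∀ t, φ t = f (pt x t)) :
    partialFourierInv g x = (𝓕 φ : 𝓢(ℝ, ℂ)) := by
  have hinv : 𝓕⁻ (partialFourierInv g x) = φ := by
    ext y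
    have h := fourierInv_mul_snd (m := fun _ => 1) (g := g)
      (by simpa using g.integrable (μ := volume)) x y
    simp only [one_mul] at h
    rw [hφ y, hfg, h, fourierInv_eq_integral_e]
    refine integral_congr_ae (Eventually.of_forall fun η => ?_)
    simp [mul_comm]
  have hF : Integrable (𝓕 (partialFourierInv g x)) := by
    have h := (φ.integrable (μ := volume)).comp_neg
    rw [← hinv] at h
    simpa [Real.fourierInv_eq_fourier_neg] using h
  have h := (continuous_partialFourierInv g x).fourier_fourierInv_eq
    (integrable_partialFourierInv g.integrable x) hF
  rw [← h, hinv, SchwartzMap.fourier_coe]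

end Slices

/-! ### Assembly of the inversion formula. -/

section Inversion

variable {n : ℕ}

theorem integrable_norm_div_pow_mul (g : 𝓢(XY n, ℂ)) :
    Integrable fun k : XY n => ((‖k‖ / ‖k‖ ^ n : ℝ) : ℂ) * g k := by
  have := g.continuous.measurable
  refine integrable_of_weight (m := 0) (Measurable.aestronglyMeasurable (by fun_prop)) ?_
  exact integrable_weight_mul g 0

theorem integrable_I_sign_snd_mul {H : XY n → ℂ} (hH : Integrable H) :
    Integrable fun k : XY n => Complex.I * (Real.sign k.snd : ℂ) * H k := by
  refine ((integrable_sign_snd_mul hH).const_mul Complex.I).congr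
    (Eventually.of_forall fun k => ?_)
  simp only [mul_assoc]

theorem modBackproj_eq_fourierInv {g : 𝓢(XY n, ℂ)} {f : XY n → ℂ}
    (hfg : f = 𝓕⁻ (g : XY n → ℂ)) (hg : ∀ k, g (reflectSnd n k) = g k)
    (hint : ∀ (x : X n) (y : ℝ), Integrable fun z => deriv (fun t : ℝ => bp (R f) x t z) y) :
    modBackproj (R f) = 𝓕⁻ (fun k : XY n => (4 * Real.pi * Complex.I * ((sphereArea n)⁻¹ : ℝ)) *
      ((Real.sign k.snd : ℂ) * (((‖k‖ / ‖k‖ ^ n : ℝ) : ℂ) * g k))) := by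
  ext p
  subst hfg
  have hH := integrable_norm_div_pow_mul g
  have h1 := modBackproj_eq_of_integrable g p.fst p.snd (hint p.fst p.snd)
  have h2 := integral_sine_eq_fourierInv_sign hH
    (fun k => by rw [hg, (reflectSnd n).norm_map]) p.fst p.snd
  change modBackproj (R (𝓕⁻ (g : XY n → ℂ))) (pt p.fst p.snd) = _
  rw [h1]
  have h3 : 𝓕⁻ (fun k : XY n => (4 * Real.pi * Complex.I * ((sphereArea n)⁻¹ : ℝ)) *
      ((Real.sign k.snd : ℂ) * (((‖k‖ / ‖k‖ ^ n : ℝ) : ℂ) * g k))) p =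
      (4 * Real.pi * Complex.I * ((sphereArea n)⁻¹ : ℝ)) *
      𝓕⁻ (fun k : XY n => (Real.sign k.snd : ℂ) * (((‖k‖ / ‖k‖ ^ n : ℝ) : ℂ) * g k)) p := by
    rw [fourierInv_eq_integral_e, fourierInv_eq_integral_e, ← integral_const_mul]
    refine integral_congr_ae (Eventually.of_forall fun k => ?_)
    simp only
    ring
  rw [h3]
  change _ = _ * 𝓕⁻ (fun k : XY n => (Real.sign k.snd : ℂ) *
    (((‖k‖ / ‖k‖ ^ n : ℝ) : ℂ) * g k)) (pt p.fst p.snd)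
  rw [← h2]
  generalize (∫ k : XY n, e ⟪k.fst, p.fst⟫ * (((‖k‖ / ‖k‖ ^ n : ℝ) : ℂ) * g k) *
    (Real.sin (2 * Real.pi * (p.snd * |k.snd|)) : ℝ)) = J
  push_cast
  linear_combination (-(4 * Real.pi * (sphereArea n : ℂ)⁻¹ * J)) * Complex.I_sq

theorem c_pos : 0 < c n := by
  have := sphereArea_pos (n := n)
  unfold c
  positivity

/-- The powers of `‖k‖` cancel, and `(2π)^(n-1) * 4π / |Sⁿ| = 2 (2π)^n / |Sⁿ|` is `(c n)⁻¹`. At `k =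
0` both sides vanish because `Real.sign 0 = 0`. -/
theorem multiplier_mul_eq (g : XY n → ℂ) (k : XY n) :
    (((2 * Real.pi * ‖k‖) ^ (2 * (((n : ℝ) - 1) / 2)) : ℝ) : ℂ) *
      ((4 * Real.pi * Complex.I * ((sphereArea n)⁻¹ : ℝ)) *
        ((Real.sign k.snd : ℂ) * (((‖k‖ / ‖k‖ ^ n : ℝ) : ℂ) * g k))) =
      Complex.I * (Real.sign k.snd : ℂ) * (((c n)⁻¹ : ℝ) * g k) := by
  rcases eq_or_ne k 0 with rfl | hk
  · simp
  have hpos : 0 < ‖k‖ := norm_pos_iff.2 hk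
  have hS := sphereArea_pos (n := n)
  have h1 : (2 * Real.pi * ‖k‖) ^ (2 * (((n : ℝ) - 1) / 2)) =
      (2 * Real.pi * ‖k‖) ^ n / (2 * Real.pi * ‖k‖) := by
    rw [mul_div_cancel₀ _ two_ne_zero, Real.rpow_sub_one (by positivity), Real.rpow_natCast]
  have h2 : (2 * Real.pi * ‖k‖) ^ (2 * (((n : ℝ) - 1) / 2)) *
      (4 * Real.pi * (sphereArea n)⁻¹) * (‖k‖ / ‖k‖ ^ n) = (c n)⁻¹ := by
    rw [h1, c, mul_pow, inv_div]
    field_simp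
    ring
  rw [← h2]
  push_cast
  ring

theorem isFracLaplacian_modBackproj {g : 𝓢(XY n, ℂ)} {f : XY n → ℂ}
    (hfg : f = 𝓕⁻ (g : XY n → ℂ)) (hg : ∀ k, g (reflectSnd n k) = g k)
    (hint : ∀ (x : X n) (y : ℝ), Integrable fun z => deriv (fun t : ℝ => bp (R f) x t z) y) :
    IsFracLaplacian (((n : ℝ) - 1) / 2) (modBackproj (R f))
      (𝓕⁻ fun k : XY n => Complex.I * (Real.sign k.snd : ℂ) * (((c n)⁻¹ : ℝ) * g k)) := by
  have hH := integrable_norm_div_pow_mul g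
  have hV := integrable_I_sign_snd_mul (g.integrable.const_mul (((c n)⁻¹ : ℝ) : ℂ))
  refine ⟨continuous_fourierInv hV,
    fun k => (4 * Real.pi * Complex.I * ((sphereArea n)⁻¹ : ℝ)) *
      ((Real.sign k.snd : ℂ) * (((‖k‖ / ‖k‖ ^ n : ℝ) : ℂ) * g k)), ?_, ?_⟩
  · rw [modBackproj_eq_fourierInv hfg hg hint]
    exact isFourierTransform_fourierInv ((integrable_sign_snd_mul hH).const_mul _)
  · simp only [multiplier_mul_eq]
    exact isFourierTransform_fourierInv hV

/-- The multiplier `i sgn` depends on the last frequency only, so on a vertical line it acts as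
`signTransform` on `(c n)⁻¹` times the one-dimensional transform of the slice of `f`. -/
theorem isHilbertTransform_slice {g : 𝓢(XY n, ℂ)} {f : XY n → ℂ}
    (hfg : f = 𝓕⁻ (g : XY n → ℂ)) (hf : ContDiff ℝ ∞ f) (hsupp : HasCompactSupport f) (x : X n) :
    IsHilbertTransform (fun t : ℝ =>
      𝓕⁻ (fun k : XY n => Complex.I * (Real.sign k.snd : ℂ) * (((c n)⁻¹ : ℝ) * g k)) (pt x t))
      (fun y : ℝ => (((c n)⁻¹ : ℝ) : ℂ) * f (pt x y)) := by
  set φ : 𝓢(ℝ, ℂ) := (hasCompactSupport_slice hsupp x).toSchwartzMap (contDiff_slice hf x)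
  have hφ : ∀ t, φ t = f (pt x t) := fun t => rfl
  have hψ := partialFourierInv_eq_fourier hfg x φ hφ
  have hV := integrable_I_sign_snd_mul (g.integrable.const_mul (((c n)⁻¹ : ℝ) : ℂ))
  have hmain := isHilbertTransform_signTransform ((((c n)⁻¹ : ℝ) : ℂ) • 𝓕 φ)
  convert hmain using 1
  · ext t
    rw [fourierInv_mul_snd (m := fun η => Complex.I * (Real.sign η : ℂ))
      (g := fun k => (((c n)⁻¹ : ℝ) : ℂ) * g k) hV, signTransform]
    refine integral_congr_ae (Eventually.of_forall fun η => ?_)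
    have : partialFourierInv (fun k => (((c n)⁻¹ : ℝ) : ℂ) * g k) x η =
        (((c n)⁻¹ : ℝ) : ℂ) * (𝓕 φ) η := by
      rw [← hψ]
      unfold partialFourierInv
      rw [← integral_const_mul]
      refine integral_congr_ae (Eventually.of_forall fun ξ => ?_)
      simp only
      ring
    simp only [this, smul_apply, smul_eq_mul]
  · ext y
    have h : φ y = ∫ η, e (η * y) * (𝓕 φ) η := by
      have h1 : 𝓕⁻ (𝓕 φ) = φ := FourierTransform.fourierInv_fourier_eq φ
      rw [← h1, SchwartzMap.fourierInv_coe, fourierInv_eq_integral_e, h1]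
      refine integral_congr_ae (Eventually.of_forall fun η => ?_)
      simp [mul_comm]
    rw [← hφ, h, ← integral_const_mul]
    refine integral_congr_ae (Eventually.of_forall fun η => ?_)
    simp only [smul_apply, smul_eq_mul]
    ring

end Inversion

end SphericalRadon

open SphericalRadon
theorem mainTheorem1 (n : ℕ) (hn : 1 ≤ n) (f : XY n → ℂ)
    (hf_smooth : ContDiff ℝ ∞ f) (hf_supp : HasCompactSupport f)
    (hf_even : ∀ (x : X n) (y : ℝ), f (pt x (-y)) = f (pt x y)) :
    -- the integrals in `R f` and in the modified backprojection converge absolutely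
    ((∀ (x : X n) (r : ℝ), Integrable
        (fun w : Sph n => f (pt (x + r • (w : XY n).fst) (r * (w : XY n).snd))) (surface n)) ∧
      ∀ (x : X n) (y : ℝ),
        (∀ z : X n, DifferentiableAt ℝ (fun t : ℝ => bp (R f) x t z) y) ∧
        Integrable (fun z : X n => deriv (fun t : ℝ => bp (R f) x t z) y)) ∧
    -- `(-Δ)^((n-1)/2)` of the modified backprojection is one well-defined continuous function `v`,
    -- and `f = c_n H_y v`
    (∃! v : XY n → ℂ, IsFracLaplacian (((n : ℝ) - 1) / 2) (modBackproj (R f)) v) ∧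
    (∀ v : XY n → ℂ, IsFracLaplacian (((n : ℝ) - 1) / 2) (modBackproj (R f)) v →
      ∃ h : XY n → ℂ,
        (∀ x : X n, IsHilbertTransform (fun t : ℝ => v (pt x t)) (fun y : ℝ => h (pt x y))) ∧
        ∀ p : XY n, f p = (c n : ℂ) * h p) ∧
    -- without the derivative, the backprojection integral diverges, for `f ≥ 0`,
    -- at each point where `f > 0`
    ((∀ p : XY n, ∃ a : ℝ, 0 ≤ a ∧ f p = (a : ℂ)) →
      ∀ (x : X n) (y : ℝ), f (pt x y) ≠ 0 → ¬ Integrable (fun z : X n => bp (R f) x y z)) := by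
  set F : 𝓢(XY n, ℂ) := hf_supp.toSchwartzMap hf_smooth
  set g : 𝓢(XY n, ℂ) := 𝓕 F
  have hfg : f = 𝓕⁻ (g : XY n → ℂ) := by
    have h : 𝓕⁻ g = F := FourierTransform.fourierInv_fourier_eq F
    rw [← SchwartzMap.fourierInv_coe, h]
    rfl
  have hg : ∀ k, g (reflectSnd n k) = g k := fourier_reflectSnd (f := f) hf_even
  obtain ⟨K, hK⟩ := hf_smooth.lipschitzWith_of_hasCompactSupport hf_supp (by simp)
  obtain ⟨A, hA⟩ := exists_norm_bound_of_hasCompactSupport hf_supp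
  have hint : ∀ (x : X n) (y : ℝ),
      Integrable fun z => deriv (fun t : ℝ => bp (R f) x t z) y :=
    integrable_deriv_bp g hfg hK hA
  have hfrac := isFracLaplacian_modBackproj hfg hg hint
  have hc : (c n : ℂ) ≠ 0 := by exact_mod_cast (c_pos (n := n)).ne'
  refine ⟨⟨fun x r => integrable_sphere (hf_smooth.continuous.comp (by fun_prop)),
    fun x y => ⟨fun z => ?_, hint x y⟩⟩, ⟨_, hfrac, fun v hv => hv.unique hfrac⟩, fun v hv => ?_,
    fun hpos x y hxy => not_integrable_bp hn hf_smooth.continuous hpos x y hxy⟩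
  · rw [hfg]
    exact (hasDerivAt_bp_R_fourierInv g.integrable
      (schwartz_integrable_norm_mul g) x y z).differentiableAt
  · refine ⟨fun p => (((c n)⁻¹ : ℝ) : ℂ) * f p, fun x => ?_, fun p => ?_⟩
    · rw [hv.unique hfrac]
      exact isHilbertTransform_slice hfg hf_smooth hf_supp x
    · rw [Complex.ofReal_inv, mul_inv_cancel_left₀ hc]
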